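/- Let $E$ be an $n$-dimensional euclidean space, $n\ge 1$, and let $\sigma_0\subset E$ be an $n$-simplex all of whose dihedral angles have the form $\pi/m(i,j)$ with $m(i,j)\ge 2$ an integer (for $n=1$, where the two facets are parallel, $m=\infty$). Let $W$ be the group of isometries of $E$ generated by the reflections in the facets of $\sigma_0$; these groups are precisely the irreducible euclidean Coxeter groups. The Coxeter diagram $\Gamma$ has the facets of $\sigma_0$ as vertices and an edge between two facets whenever $m(i,j)>2$. Assume that $W$ is not of type $\widetilde A_n$, that is, $n\ge 2$ and $\Gamma$ is not a cycle through all $n+1$ vertices with all edges having $m=3$. The chambers are the images of $\sigma_0$ under elements of $W$; the facets of every chamber are canonically identified, via $W$, with the vertices of $\Gamma$. A Coxeter element of $W$ is a product, in some linear order, of the $n+1$ reflections in the facets of some chamber. A linear order of the facets orients every edge of $\Gamma$ from its earlier to its later endpoint. A chamber $\sigma$ produces $w$ as a bipartite Coxeter element if $w$ is the product of the reflections in the facets of $\sigma$ in a linear order for which every vertex of $\Gamma$ is a source or a sink. The axis of a Coxeter element $w$ is its min-set, i.e. the set of points $x\in E$ for which the distance from $x$ to $w(x)$ is minimal (it is a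 line). Theorem (Axial chambers and Coxeter elements). Let $L$ be the axis of a Coxeter element $w$ of an irreducible euclidean Coxeter group $W$ that is not of type $A$, and let $\sigma$ be a chamber. Then $\sigma$ produces $w$ as a bipartite Coxeter element if and only if $L$ intersects the interior of $\sigma$. -/

import Mathlib

noncomputable section

namespace EuclideanCoxeter

/-! ### Coxeter diagrams -/

/-- The Coxeter diagram of a Coxeter matrix: distinct `i`, `j` are joined by an edge when
`m(i, j) > 2`, where `m(i, j) = ∞` is encoded by `M i j = 0` and counts as an edge. -/
def diagram {ι : Type*} (M : CoxeterMatrix ι) : SimpleGraph ι where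
  Adj i j := i ≠ j ∧ M i j ≠ 2
  symm := ⟨fun i j h => ⟨h.1.symm, by rw [M.symmetric]; exact h.2⟩⟩
  loopless := ⟨fun _ h => h.1 rfl⟩

/-- The Coxeter matrix of type `Ã_n`, for `n ≥ 1`. For `n = 1` it is the infinite dihedral matrix
(`m = ∞`, encoded by `0`); for `n ≥ 2` the diagram is a cycle of length `n + 1` all of whose edges
have `m = 3`. The addition of `Fin (n + 1)` is cyclic. -/
def affineA (n : ℕ) : CoxeterMatrix (Fin (n + 1)) where
  M := Matrix.of fun i j =>
    if i = j then 1 else if n = 1 then 0 else if j = i + 1 ∨ i = j + 1 then 3 else 2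
  isSymm := by
    ext i j
    simp only [Matrix.transpose_apply, Matrix.of_apply, eq_comm (a := j) (b := i),
      or_comm (a := i = j + 1)]
  diagonal := by simp
  off_diagonal := by
    intro i j h
    simp only [Matrix.of_apply, h, if_false]
    split_ifs <;> decide

/-- A Coxeter matrix on `n + 1` generators is of type `Ã_n` if it agrees with `affineA n` up to
renaming the generators. -/
def IsTypeA {n : ℕ} (M : CoxeterMatrix (Fin (n + 1))) : Prop :=
  ∃ e : Equiv.Perm (Fin (n + 1)), M.reindex e = affineA n

/-- Position `k` of a linear ordering `e` is occupied by the generator `e k`. In the acyclic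
orientation of the diagram induced by `e`, an edge points from its earlier to its later endpoint.
A source is a vertex that precedes all of its neighbours. -/
def IsSource {n : ℕ} (M : CoxeterMatrix (Fin (n + 1))) (e : Equiv.Perm (Fin (n + 1)))
    (i : Fin (n + 1)) : Prop :=
  ∀ j, (diagram M).Adj i j → e.symm i < e.symm j

/-- A sink of the orientation induced by the linear ordering `e`: a vertex that comes after all of
its neighbours. -/
def IsSink {n : ℕ} (M : CoxeterMatrix (Fin (n + 1))) (e : Equiv.Perm (Fin (n + 1)))
    (i : Fin (n + 1)) : Prop :=
  ∀ j, (diagram M).Adj i j → e.symm j < e.symm i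

/-- The orientation induced by the linear ordering `e` makes every vertex a source or a sink. -/
def IsBipartiteOrdering {n : ℕ} (M : CoxeterMatrix (Fin (n + 1)))
    (e : Equiv.Perm (Fin (n + 1))) : Prop :=
  ∀ i, IsSource M e i ∨ IsSink M e i

/-! ### Coxeter simplices, their reflection groups and chambers -/

section Geometry

variable {V P : Type*} [NormedAddCommGroup V] [InnerProductSpace ℝ V] [MetricSpace P]
  [NormedAddTorsor V P] {n : ℕ} [NeZero n]

/-- The hyperplane spanned by the facet of `σ` opposite to its `i`-th vertex. -/
abbrev facetHyperplane (σ : Affine.Simplex ℝ P n) (i : Fin (n + 1)) : AffineSubspace ℝ P :=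
  affineSpan ℝ (Set.range (σ.faceOpposite i).points)

/-- The reflection of the ambient space that fixes the `i`-th facet hyperplane of `σ`. -/
def facetReflection (σ : Affine.Simplex ℝ P n) (i : Fin (n + 1)) : P ≃ᵃⁱ[ℝ] P :=
  EuclideanGeometry.reflection (facetHyperplane σ i)

/-- An outward pointing normal vector of the `i`-th facet: the vector from the `i`-th vertex to the
foot of its altitude. -/
def outwardNormal (σ : Affine.Simplex ℝ P n) (i : Fin (n + 1)) : V :=
  σ.altitudeFoot i -ᵥ σ.points i

/-- `σ` is the euclidean simplex encoded by the Coxeter matrix `M`: it spans the whole space, its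
facets are indexed by the vertices of the diagram, and the angle between the outward normals of two
facets is `π - π / m`, so that their dihedral angle is `π / m`. For `m = ∞`, encoded by `0`, the
division convention gives the angle `π`, i.e. parallel facets; this occurs only for `n = 1`.
The diagram of such a simplex is automatically connected, and the matrices that arise are those of
the extended Dynkin diagrams, i.e. of the irreducible euclidean Coxeter groups. -/
structure IsCoxeterSimplex (σ : Affine.Simplex ℝ P n) (M : CoxeterMatrix (Fin (n + 1))) :
    Prop where
  span_eq_top : affineSpan ℝ (Set.range σ.points) = ⊤
  angle_eq : ∀ i j, i ≠ j →
    InnerProductGeometry.angle (outwardNormal σ i) (outwardNormal σ j) =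
      Real.pi - Real.pi / (M i j : ℝ)

/-- The group of isometries generated by the reflections in the facets of `σ`. -/
def reflectionGroup (σ : Affine.Simplex ℝ P n) : Subgroup (P ≃ᵃⁱ[ℝ] P) :=
  Subgroup.closure (Set.range (facetReflection σ))

/-- `τ` is a chamber of the Coxeter complex with fundamental chamber `σ`: an image of `σ` under an
element of the reflection group. The facets of `τ` carry the labels transported from `σ`, which is
the canonical identification of the facets of a chamber with the vertices of the diagram. -/
def IsChamber (σ τ : Affine.Simplex ℝ P n) : Prop :=
  ∃ g ∈ reflectionGroup σ, ∀ i, τ.points i = g (σ.points i)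

/-- The product, in the linear order `e`, of the reflections in the facets of `τ`. -/
def orderedProduct (τ : Affine.Simplex ℝ P n) (e : Equiv.Perm (Fin (n + 1))) : P ≃ᵃⁱ[ℝ] P :=
  (List.ofFn fun k => facetReflection τ (e k)).prod

/-- `w` is a Coxeter element of the reflection group of `σ`: the product, in some linear order, of
the reflections of a simple system, that is, of the reflections in the facets of some chamber. -/
def IsCoxeterElement (σ : Affine.Simplex ℝ P n) (w : P ≃ᵃⁱ[ℝ] P) : Prop :=
  ∃ τ, IsChamber σ τ ∧ ∃ e, w = orderedProduct τ e

/-- The chamber `τ` produces `w` as a bipartite Coxeter element: `w` is the product of the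
reflections in the facets of `τ` in a linear order for which every vertex of the diagram is a source
or a sink. -/
def ProducesBipartite (M : CoxeterMatrix (Fin (n + 1))) (τ : Affine.Simplex ℝ P n)
    (w : P ≃ᵃⁱ[ℝ] P) : Prop :=
  ∃ e, IsBipartiteOrdering M e ∧ w = orderedProduct τ e

end Geometry

/-- The min-set of an isometry: the set of points that are moved the shortest distance. For a
Coxeter element of an irreducible euclidean Coxeter group this is its axis. -/
def minSet {V P : Type*} [NormedAddCommGroup V] [InnerProductSpace ℝ V] [MetricSpace P]
    [NormedAddTorsor V P] (w : P ≃ᵃⁱ[ℝ] P) : Set P :=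
  {x | ∀ y, dist x (w x) ≤ dist y (w y)}

end EuclideanCoxeter

end

noncomputable section

namespace EuclideanCoxeter

open scoped RealInnerProductSpace
open Affine

/-! ### Distances to the facet hyperplanes as barycentric coordinates. -/

section WallFunctions

variable {V P : Type*} [NormedAddCommGroup V] [InnerProductSpace ℝ V] [MetricSpace P]
  [NormedAddTorsor V P] {n : ℕ}

/-! Let `u i` be the inward unit normals of a chamber and `h i` its heights. Up to scale, the only
linear relation among the normals is `∑ (h i)⁻¹ • u i = 0`, and all its coefficients are positive.
If the diagram contained a cycle, the sum of the normals along it would have squared norm at most 0.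
It would then be a relation, so the cycle would contain every vertex and all its labels would be 3,
which is type `Ã`. Hence the diagram is a forest (`isAcyclic_diagram`).

In a forest, bipartite orderings exist and products in different orders are conjugate inside the
group (`exists_conj_of_perm`). So every Coxeter element is `w = a * b` for some chamber `τ`, where
`a` and `b` are products of commuting reflections over the sources `A` and over `Aᶜ`
(`IsCoxeterElement.exists_bipartite`, `IsBipartiteOrdering.exists_part`).

The displacement of `w` has constant inner product with `∑ i ∈ A, (h i)⁻¹ • u i`. It is therefore
shortest where it is parallel to this vector, which happens on an explicit line (`mem_minSet_iff`).
With a parameter `t` on the line, `a` acts by `t ↦ -t` and `b` by `t ↦ 2T - t`, and the closed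
chamber `τ` cuts out `0 ≤ t ≤ T`. Interior points of this segment give the forward direction.

Conversely, let a point of the axis lie inside `σ`. Some `h` in the dihedral group of `a` and `b`
moves it into the closure of `τ` and conjugates `w` to `w` or `w⁻¹`
(`OnAxis.exists_wallDist_nonneg`). Chambers have disjoint interiors by Tits' lemma, so `σ = h⁻¹ τ`
(`IsChamber.eq_of_wallDist`), and `σ` produces `w` in the ordering of `τ` or in its reverse, which
is again bipartite. -/

lemma exists_eq_affineCombination {σ : Simplex ℝ P n}
    (hσ : affineSpan ℝ (Set.range σ.points) = ⊤) (x : P) :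
    ∃ w : Fin (n + 1) → ℝ, ∑ j, w j = 1 ∧ x = Finset.univ.affineCombination ℝ σ.points w :=
  eq_affineCombination_of_mem_affineSpan_of_fintype (hσ ▸ AffineSubspace.mem_top ℝ V x)

variable [NeZero n]

/-- The inward pointing unit normal vector of the `i`-th facet. -/
def unitNormal (σ : Simplex ℝ P n) (i : Fin (n + 1)) : V :=
  (σ.height i)⁻¹ • (σ.points i -ᵥ σ.altitudeFoot i)

/-- The signed distance from the `i`-th facet hyperplane, positive on the side of the simplex. -/
def wallDist (σ : Simplex ℝ P n) (i : Fin (n + 1)) (x : P) : ℝ :=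
  ⟪unitNormal σ i, x -ᵥ σ.altitudeFoot i⟫

lemma norm_unitNormal (σ : Simplex ℝ P n) (i : Fin (n + 1)) : ‖unitNormal σ i‖ = 1 := by
  have h := σ.height_pos i
  rw [unitNormal, norm_smul, ← dist_eq_norm_vsub, ← Simplex.height, norm_inv, Real.norm_eq_abs,
    abs_of_pos h, inv_mul_cancel₀ h.ne']

lemma inner_unitNormal_self (σ : Simplex ℝ P n) (i : Fin (n + 1)) :
    ⟪unitNormal σ i, unitNormal σ i⟫ = 1 := by
  rw [real_inner_self_eq_norm_sq, norm_unitNormal, one_pow]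

lemma wallDist_vadd (σ : Simplex ℝ P n) (i : Fin (n + 1)) (v : V) (x : P) :
    wallDist σ i (v +ᵥ x) = ⟪unitNormal σ i, v⟫ + wallDist σ i x := by
  rw [wallDist, vadd_vsub_assoc, inner_add_right, wallDist]

lemma wallDist_point_of_ne (σ : Simplex ℝ P n) {i j : Fin (n + 1)} (h : j ≠ i) :
    wallDist σ i (σ.points j) = 0 := by
  rw [wallDist, unitNormal, inner_smul_left, real_inner_comm,
    σ.inner_vsub_altitudeFoot_vsub_altitudeFoot_eq_zero h.symm, mul_zero]

lemma wallDist_point_self (σ : Simplex ℝ P n) (i : Fin (n + 1)) :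
    wallDist σ i (σ.points i) = σ.height i := by
  have h := σ.height_pos i
  rw [wallDist, unitNormal, inner_smul_left, real_inner_self_eq_norm_sq, ← dist_eq_norm_vsub,
    ← Simplex.height]
  simp only [conj_trivial]
  field_simp

/-- The wall function is affine and vanishes at every vertex but the `i`-th. Divided by the height
it is the `i`-th barycentric coordinate. -/
lemma wallDist_affineCombination (σ : Simplex ℝ P n) (i : Fin (n + 1)) {w : Fin (n + 1) → ℝ}
    (hw : ∑ j, w j = 1) :
    wallDist σ i (Finset.univ.affineCombination ℝ σ.points w) = w i * σ.height i := by
  rw [wallDist, ← Finset.sum_smul_vsub_const_eq_affineCombination_vsub _ _ _ _ hw, inner_sum,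
    Finset.sum_eq_single i]
  · rw [inner_smul_right]
    congr 1
    exact wallDist_point_self σ i
  · intro j _ hj
    rw [inner_smul_right]
    exact mul_eq_zero_of_right _ (wallDist_point_of_ne σ hj)
  · simp

lemma sum_wallDist {σ : Simplex ℝ P n} (hσ : affineSpan ℝ (Set.range σ.points) = ⊤) (x : P) :
    ∑ i, (σ.height i)⁻¹ * wallDist σ i x = 1 := by
  obtain ⟨w, hw, rfl⟩ := exists_eq_affineCombination hσ x
  rw [← hw]
  refine Finset.sum_congr rfl fun i _ => ?_
  have h := σ.height_pos i
  rw [wallDist_affineCombination σ i hw]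
  field_simp

lemma exists_wallDist_eq (σ : Simplex ℝ P n) {d : Fin (n + 1) → ℝ}
    (hd : ∑ i, (σ.height i)⁻¹ * d i = 1) : ∃ x, ∀ i, wallDist σ i x = d i := by
  refine ⟨Finset.univ.affineCombination ℝ σ.points fun i => (σ.height i)⁻¹ * d i, fun i => ?_⟩
  have h := σ.height_pos i
  rw [wallDist_affineCombination σ i hd]
  field_simp

lemma mem_interior_iff_wallDist_pos {σ : Simplex ℝ P n}
    (hσ : affineSpan ℝ (Set.range σ.points) = ⊤) {x : P} :
    x ∈ σ.interior ↔ ∀ i, 0 < wallDist σ i x := by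
  obtain ⟨w, hw, rfl⟩ := exists_eq_affineCombination hσ x
  rw [Simplex.affineCombination_mem_interior_iff hw]
  simp_rw [wallDist_affineCombination σ _ hw, mul_pos_iff_of_pos_right (σ.height_pos _)]
  refine ⟨fun h i => (h i).1, fun h i => ⟨h i, ?_⟩⟩
  -- Membership in the interior also bounds each weight above by 1; this needs a second vertex of
  -- positive weight.
  have : Nontrivial (Fin (n + 1)) := Fin.nontrivial_iff_two_le.2 (by have := NeZero.pos n; omega)
  obtain ⟨j, hj⟩ := exists_ne i
  rw [← hw]
  exact Finset.single_lt_sum hj (Finset.mem_univ i) (Finset.mem_univ j) (h j)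
    fun k _ _ => (h k).le

/-- The linear part of the identity saying that barycentric coordinates sum to 1. -/
lemma sum_smul_unitNormal {σ : Simplex ℝ P n} (hσ : affineSpan ℝ (Set.range σ.points) = ⊤) :
    ∑ i, (σ.height i)⁻¹ • unitNormal σ i = 0 := by
  refine ext_inner_right ℝ fun v => ?_
  have h1 := sum_wallDist hσ (σ.points 0)
  have h2 := sum_wallDist hσ (v +ᵥ σ.points 0)
  simp_rw [wallDist_vadd, mul_add, Finset.sum_add_distrib, h1] at h2
  simp_rw [sum_inner, inner_smul_left, inner_zero_left, conj_trivial]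
  linarith

/-- A relation among the normals makes `∑ d i * wallDist σ i` constant, and its value at the `k`-th
vertex is `d k * σ.height k`. In particular a nontrivial relation involves every facet. -/
lemma eq_smul_of_sum_smul_unitNormal_eq_zero (σ : Simplex ℝ P n) {d : Fin (n + 1) → ℝ}
    (hd : ∑ i, d i • unitNormal σ i = 0) : ∃ μ : ℝ, ∀ i, d i = μ * (σ.height i)⁻¹ := by
  have key : ∀ x y : P, ∑ i, d i * wallDist σ i x = ∑ i, d i * wallDist σ i y := by
    intro x y
    have : ⟪∑ i, d i • unitNormal σ i, x -ᵥ y⟫ = 0 := by rw [hd, inner_zero_left]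
    simp_rw [sum_inner, inner_smul_left, conj_trivial] at this
    conv_lhs => rw [← vsub_vadd x y]
    simp_rw [wallDist_vadd, mul_add, Finset.sum_add_distrib, this, zero_add]
  have hk : ∀ k, ∑ i, d i * wallDist σ i (σ.points k) = d k * σ.height k := by
    intro k
    rw [Finset.sum_eq_single k, wallDist_point_self]
    · intro j _ hj
      rw [wallDist_point_of_ne σ hj.symm, mul_zero]
    · simp
  refine ⟨d 0 * σ.height 0, fun i => ?_⟩
  rw [← hk 0, key _ (σ.points i), hk i, mul_inv_cancel_right₀ (σ.height_pos i).ne']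

lemma wallDist_eq_zero_of_mem {σ : Simplex ℝ P n} {i : Fin (n + 1)} {x : P}
    (hx : x ∈ facetHyperplane σ i) : wallDist σ i x = 0 := by
  rw [wallDist, unitNormal, inner_smul_left, real_inner_comm]
  refine mul_eq_zero_of_right _ (Submodule.inner_right_of_mem_orthogonal
    (AffineSubspace.vsub_mem_direction hx (σ.altitudeFoot_mem_affineSpan_faceOpposite i)) ?_)
  exact EuclideanGeometry.vsub_orthogonalProjection_mem_direction_orthogonal _ _

lemma mem_facetHyperplane_iff {σ : Simplex ℝ P n}
    (hσ : affineSpan ℝ (Set.range σ.points) = ⊤) {i : Fin (n + 1)} {x : P} :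
    x ∈ facetHyperplane σ i ↔ wallDist σ i x = 0 := by
  refine ⟨wallDist_eq_zero_of_mem, fun h => ?_⟩
  obtain ⟨w, hw, rfl⟩ := exists_eq_affineCombination hσ x
  rw [wallDist_affineCombination σ i hw] at h
  have hi : w i = 0 := (mul_eq_zero.1 h).resolve_right (σ.height_pos i).ne'
  rw [facetHyperplane, Simplex.range_faceOpposite_points]
  refine affineCombination_mem_affineSpan_image (k := ℝ) hw (fun j _ hj => ?_) _
  rw [show j = i by simpa using hj, hi]

lemma unitNormal_mem_orthogonal (σ : Simplex ℝ P n) (i : Fin (n + 1)) :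
    unitNormal σ i ∈ (facetHyperplane σ i).directionᗮ :=
  Submodule.smul_mem _ _
    (EuclideanGeometry.vsub_orthogonalProjection_mem_direction_orthogonal _ _)

lemma facetReflection_apply {σ : Simplex ℝ P n}
    (hσ : affineSpan ℝ (Set.range σ.points) = ⊤) (i : Fin (n + 1)) (x : P) :
    facetReflection σ i x = (-(2 * wallDist σ i x)) • unitNormal σ i +ᵥ x := by
  set y : P := (-wallDist σ i x) • unitNormal σ i +ᵥ x with hy
  have hym : y ∈ facetHyperplane σ i := by
    rw [mem_facetHyperplane_iff hσ, hy, wallDist_vadd, inner_smul_right, inner_unitNormal_self]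
    ring
  have hxy : x = (wallDist σ i x) • unitNormal σ i +ᵥ y := by
    rw [hy, vadd_vadd, ← add_smul]
    simp
  rw [facetReflection]
  conv_lhs => rw [hxy]
  rw [EuclideanGeometry.reflection_orthogonal_vadd hym
    (Submodule.smul_mem _ _ (unitNormal_mem_orthogonal σ i)), hy, vadd_vadd, ← neg_smul,
    ← add_smul]
  congr 2
  ring

lemma wallDist_facetReflection {σ : Simplex ℝ P n}
    (hσ : affineSpan ℝ (Set.range σ.points) = ⊤) (i j : Fin (n + 1)) (x : P) :
    wallDist σ i (facetReflection σ j x) =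
      wallDist σ i x - 2 * ⟪unitNormal σ i, unitNormal σ j⟫ * wallDist σ j x := by
  rw [facetReflection_apply hσ, wallDist_vadd, inner_smul_right]
  ring

lemma facetReflection_mul_self (σ : Simplex ℝ P n) (i : Fin (n + 1)) :
    facetReflection σ i * facetReflection σ i = 1 := by
  ext x
  change facetReflection σ i (facetReflection σ i x) = x
  rw [facetReflection, EuclideanGeometry.reflection_reflection]

end WallFunctions

/-! ### Images of simplices under isometries. -/

section Transport

variable {V P : Type*} [NormedAddCommGroup V] [InnerProductSpace ℝ V] [MetricSpace P]
  [NormedAddTorsor V P] {n : ℕ}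

/-- The image of a simplex under an isometry. -/
def imageSimplex (g : P ≃ᵃⁱ[ℝ] P) (σ : Simplex ℝ P n) : Simplex ℝ P n :=
  σ.map g.toAffineIsometry.toAffineMap g.injective

lemma imageSimplex_points (g : P ≃ᵃⁱ[ℝ] P) (σ : Simplex ℝ P n) (i : Fin (n + 1)) :
    (imageSimplex g σ).points i = g (σ.points i) := rfl

lemma affineSpan_imageSimplex (g : P ≃ᵃⁱ[ℝ] P) {σ : Simplex ℝ P n}
    (hσ : affineSpan ℝ (Set.range σ.points) = ⊤) :
    affineSpan ℝ (Set.range (imageSimplex g σ).points) = ⊤ := by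
  have : Set.range (imageSimplex g σ).points = g.toAffineEquiv '' Set.range σ.points := by
    rw [← Set.range_comp]
    rfl
  rw [this]
  exact AffineEquiv.span_eq_top_iff g.toAffineEquiv |>.1 hσ

variable [NeZero n]

lemma altitudeFoot_imageSimplex (g : P ≃ᵃⁱ[ℝ] P) (σ : Simplex ℝ P n) (i : Fin (n + 1)) :
    (imageSimplex g σ).altitudeFoot i = g (σ.altitudeFoot i) :=
  σ.altitudeFoot_map g.toAffineIsometry i

lemma height_imageSimplex (g : P ≃ᵃⁱ[ℝ] P) (σ : Simplex ℝ P n) (i : Fin (n + 1)) :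
    (imageSimplex g σ).height i = σ.height i :=
  σ.height_map g.toAffineIsometry i

lemma outwardNormal_imageSimplex (g : P ≃ᵃⁱ[ℝ] P) (σ : Simplex ℝ P n) (i : Fin (n + 1)) :
    outwardNormal (imageSimplex g σ) i = g.linearIsometryEquiv (outwardNormal σ i) := by
  rw [outwardNormal, altitudeFoot_imageSimplex, imageSimplex_points, outwardNormal,
    AffineIsometryEquiv.map_vsub]

lemma unitNormal_imageSimplex (g : P ≃ᵃⁱ[ℝ] P) (σ : Simplex ℝ P n) (i : Fin (n + 1)) :
    unitNormal (imageSimplex g σ) i = g.linearIsometryEquiv (unitNormal σ i) := by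
  rw [unitNormal, altitudeFoot_imageSimplex, imageSimplex_points, height_imageSimplex, unitNormal,
    map_smul, AffineIsometryEquiv.map_vsub]

lemma wallDist_imageSimplex (g : P ≃ᵃⁱ[ℝ] P) (σ : Simplex ℝ P n) (i : Fin (n + 1)) (x : P) :
    wallDist (imageSimplex g σ) i (g x) = wallDist σ i x := by
  rw [wallDist, altitudeFoot_imageSimplex, unitNormal_imageSimplex,
    ← AffineIsometryEquiv.map_vsub, LinearIsometryEquiv.inner_map_map, wallDist]

lemma IsCoxeterSimplex.imageSimplex {σ : Simplex ℝ P n} {M : CoxeterMatrix (Fin (n + 1))}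
    (hσ : IsCoxeterSimplex σ M) (g : P ≃ᵃⁱ[ℝ] P) : IsCoxeterSimplex (imageSimplex g σ) M where
  span_eq_top := affineSpan_imageSimplex g hσ.span_eq_top
  angle_eq i j hij := by
    rw [outwardNormal_imageSimplex, outwardNormal_imageSimplex, ← hσ.angle_eq i j hij]
    exact LinearIsometry.angle_map g.linearIsometryEquiv.toLinearIsometry _ _

lemma facetReflection_imageSimplex (g : P ≃ᵃⁱ[ℝ] P) {σ : Simplex ℝ P n}
    (hσ : affineSpan ℝ (Set.range σ.points) = ⊤) (i : Fin (n + 1)) :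
    facetReflection (imageSimplex g σ) i = g * facetReflection σ i * g⁻¹ := by
  ext x
  obtain ⟨y, rfl⟩ := g.surjective x
  have : (g * facetReflection σ i * g⁻¹) (g y) = g (facetReflection σ i y) := by
    simp [AffineIsometryEquiv.coe_mul, AffineIsometryEquiv.coe_inv]
  rw [this, facetReflection_apply (affineSpan_imageSimplex g hσ), facetReflection_apply hσ,
    wallDist_imageSimplex, unitNormal_imageSimplex, AffineIsometryEquiv.map_vadd, map_smul]

lemma isChamber_iff {σ τ : Simplex ℝ P n} :
    IsChamber σ τ ↔ ∃ g ∈ reflectionGroup σ, τ = imageSimplex g σ := by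
  refine exists_congr fun g => and_congr_right fun _ => ⟨fun h => Simplex.ext h, ?_⟩
  rintro rfl i
  rfl

lemma facetReflection_mem (σ : Simplex ℝ P n) (i : Fin (n + 1)) :
    facetReflection σ i ∈ reflectionGroup σ :=
  Subgroup.subset_closure ⟨i, rfl⟩

lemma facetReflection_imageSimplex_mem {σ : Simplex ℝ P n}
    (hσ : affineSpan ℝ (Set.range σ.points) = ⊤) {g : P ≃ᵃⁱ[ℝ] P} (hg : g ∈ reflectionGroup σ)
    (i : Fin (n + 1)) : facetReflection (imageSimplex g σ) i ∈ reflectionGroup σ := by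
  rw [facetReflection_imageSimplex g hσ]
  exact mul_mem (mul_mem hg (facetReflection_mem σ i)) (inv_mem hg)

lemma orderedProduct_imageSimplex (g : P ≃ᵃⁱ[ℝ] P) {σ : Simplex ℝ P n}
    (hσ : affineSpan ℝ (Set.range σ.points) = ⊤) (e : Equiv.Perm (Fin (n + 1))) :
    orderedProduct (imageSimplex g σ) e = g * orderedProduct σ e * g⁻¹ := by
  rw [orderedProduct, orderedProduct, ← MulAut.conj_apply, map_list_prod, List.map_ofFn]
  congr 2
  ext1 k
  exact facetReflection_imageSimplex g hσ (e k)

end Transport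

/-! ### Alternating words in a Coxeter group. -/

section AlternatingProduct

variable {ι G : Type*} [Group G]

/-- The alternating product `s j * s i * s j * ⋯` with `k` factors. -/
def altProd (s : ι → G) : ι → ι → ℕ → G
  | _, _, 0 => 1
  | j, i, k + 1 => s j * altProd s i j k

lemma map_altProd {H : Type*} [Group H] (φ : G →* H) (s : ι → G) (j i : ι) (k : ℕ) :
    φ (altProd s j i k) = altProd (φ ∘ s) j i k := by
  induction k generalizing i j with
  | zero => simp [altProd]
  | succ k ih => simp [altProd, ih]

lemma altProd_two_mul (s : ι → G) (j i : ι) (k : ℕ) :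
    altProd s j i (2 * k) = (s j * s i) ^ k := by
  induction k with
  | zero => simp [altProd]
  | succ k ih =>
    rw [show 2 * (k + 1) = 2 * k + 1 + 1 by ring, altProd, altProd, ih, pow_succ', mul_assoc]

lemma altProd_add (s : ι → G) (j i : ι) (k l : ℕ) :
    altProd s j i (k + l) =
      altProd s j i k * if Even k then altProd s j i l else altProd s i j l := by
  induction k generalizing i j with
  | zero => simp [altProd]
  | succ k ih =>
    rw [show k + 1 + l = k + l + 1 by ring, altProd, altProd, ih, mul_assoc]
    simp only [Nat.even_add_one]
    split_ifs <;> rfl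

lemma altProd_simple {W : Type*} [Group W] {M : CoxeterMatrix ι} (cs : CoxeterSystem M W)
    (j i : ι) (k : ℕ) :
    altProd cs.simple j i k = cs.wordProd (if Even k then CoxeterSystem.alternatingWord j i k
      else CoxeterSystem.alternatingWord i j k) := by
  induction k generalizing i j with
  | zero => simp [altProd, CoxeterSystem.alternatingWord]
  | succ k ih =>
    rw [altProd, ih, ← cs.wordProd_cons]
    congr 1
    by_cases hk : Even k <;> simp [hk, Nat.even_add_one, CoxeterSystem.alternatingWord_succ']

lemma altProd_simple_comm {W : Type*} [Group W] {M : CoxeterMatrix ι} (cs : CoxeterSystem M W)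
    (j i : ι) : altProd cs.simple j i (M i j) = altProd cs.simple i j (M i j) := by
  have h := cs.wordProd_braidWord_eq i j
  rw [CoxeterSystem.braidWord, CoxeterSystem.braidWord, M.symmetric j i] at h
  rw [altProd_simple, altProd_simple]
  split_ifs
  · exact h.symm
  · exact h

lemma length_altProd_simple_le {W : Type*} [Group W] {M : CoxeterMatrix ι}
    (cs : CoxeterSystem M W) (j i : ι) (k : ℕ) : cs.length (altProd cs.simple j i k) ≤ k := by
  rw [altProd_simple]
  refine (cs.length_wordProd_le _).trans ?_
  split_ifs <;> simp

/-- A maximal alternating prefix of an element of a Coxeter group having no left descent at `i`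
but one at `j`. -/
lemma exists_altProd_mul {W : Type*} [Group W] {M : CoxeterMatrix ι} (cs : CoxeterSystem M W)
    {i j : ι} (hm : M i j ≠ 0) {g : W} (hi : ¬ cs.IsLeftDescent g i) (hj : cs.IsLeftDescent g j) :
    ∃ k h, k < M i j ∧ cs.length h < cs.length g ∧ g = altProd cs.simple j i k * h ∧
      ¬ cs.IsLeftDescent h i ∧ ¬ cs.IsLeftDescent h j := by
  classical
  let p : ℕ → Prop := fun k => ∃ h, cs.length h + k = cs.length g ∧ g = altProd cs.simple j i k * h
  have hp1 : p 1 := by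
    refine ⟨cs.simple j * g, ?_, ?_⟩
    · exact (cs.isLeftDescent_iff).1 hj
    · simp [altProd]
  have hb : ∀ k, p k → k ≤ cs.length g := by
    rintro k ⟨h, hk, -⟩
    omega
  have hk1 : 1 ≤ Nat.findGreatest p (cs.length g) := Nat.le_findGreatest (hb 1 hp1) hp1
  have hpk := Nat.findGreatest_spec (hb 1 hp1) hp1
  have hmax : ∀ l, Nat.findGreatest p (cs.length g) < l → ¬ p l := fun l hl hpl =>
    absurd (Nat.le_findGreatest (hb l hpl) hpl) (not_le.2 hl)
  set k := Nat.findGreatest p (cs.length g)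
  obtain ⟨h, hlen, hg⟩ := hpk
  -- Otherwise the braid relation rewrites the prefix to begin with `i`, making `i` a left descent
  -- of `g`.
  have hkm : k < M i j := by
    by_contra hcon
    obtain ⟨l, hl⟩ := Nat.exists_eq_add_of_le (not_lt.1 hcon)
    obtain ⟨m, hm'⟩ := Nat.exists_eq_succ_of_ne_zero hm
    apply hi
    rw [CoxeterSystem.IsLeftDescent]
    set r := if Even (M i j) then altProd cs.simple j i l else altProd cs.simple i j l
    have hr : cs.length r ≤ l := by
      simp only [r]
      split_ifs <;> exact length_altProd_simple_le _ _ _ _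
    have hgr : cs.simple i * g = altProd cs.simple j i m * (r * h) := by
      rw [hg, hl, altProd_add, altProd_simple_comm, hm', altProd, ← mul_assoc, ← mul_assoc,
        ← mul_assoc, cs.simple_mul_simple_self, one_mul, ← hm', mul_assoc]
    have h1 := cs.length_mul_le (altProd cs.simple j i m) (r * h)
    have h2 := cs.length_mul_le r h
    have h3 := length_altProd_simple_le cs j i m
    rw [hgr]
    omega
  -- A descent at the letter that would continue the prefix contradicts the maximality of `k`.
  have hnext : ¬ cs.IsLeftDescent h (if Even k then j else i) := by
    intro hd
    refine hmax (k + 1) (Nat.lt_succ_self k) ⟨cs.simple (if Even k then j else i) * h, ?_, ?_⟩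
    · have := cs.isLeftDescent_iff.1 hd
      omega
    · rw [altProd_add, hg]
      split_ifs <;> simp [altProd, mul_assoc]
  -- A descent at the last letter of the prefix would cancel against it and shorten `g`.
  have hprev : ¬ cs.IsLeftDescent h (if Even k then i else j) := by
    intro hd
    have hd' := cs.isLeftDescent_iff.1 hd
    obtain ⟨l, hl⟩ := Nat.exists_eq_succ_of_ne_zero (Nat.one_le_iff_ne_zero.1 hk1)
    have hgr : g = altProd cs.simple j i l * (cs.simple (if Even k then i else j) * h) := by
      conv_lhs => rw [hg, hl, Nat.succ_eq_add_one, altProd_add]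
      simp only [hl, Nat.succ_eq_add_one, Nat.even_add_one]
      split_ifs <;> simp_all [altProd, mul_assoc]
    have h1 := cs.length_mul_le (altProd cs.simple j i l)
      (cs.simple (if Even k then i else j) * h)
    have h3 := length_altProd_simple_le cs j i l
    rw [← hgr] at h1
    omega
  refine ⟨k, h, hkm, by omega, hg, ?_⟩
  split_ifs at hnext hprev
  · exact ⟨hprev, hnext⟩
  · exact ⟨hnext, hprev⟩

end AlternatingProduct

/-! ### Tits' lemma and the disjointness of chambers. -/

section Tits

variable {V P : Type*} [NormedAddCommGroup V] [InnerProductSpace ℝ V] [MetricSpace P]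
  [NormedAddTorsor V P] {n : ℕ} [NeZero n] {σ : Simplex ℝ P n} {M : CoxeterMatrix (Fin (n + 1))}

lemma inner_unitNormal (hσ : IsCoxeterSimplex σ M) {i j : Fin (n + 1)} (hij : i ≠ j) :
    ⟪unitNormal σ i, unitNormal σ j⟫ = -Real.cos (Real.pi / M i j) := by
  have h := congrArg Real.cos (hσ.angle_eq i j hij)
  rw [InnerProductGeometry.cos_angle, Real.cos_pi_sub] at h
  rw [← h, unitNormal, unitNormal, inner_smul_left, inner_smul_right, outwardNormal, outwardNormal,
    ← neg_vsub_eq_vsub_rev (σ.points i), ← neg_vsub_eq_vsub_rev (σ.points j), inner_neg_neg, norm_neg, norm_neg,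
    Simplex.height, Simplex.height, dist_eq_norm_vsub V, dist_eq_norm_vsub V]
  simp only [conj_trivial]
  field_simp

/-- The three-term recurrence that the wall functions satisfy along an alternating product of two
reflections. -/
lemma sin_mul_add_sin (k : ℕ) (θ : ℝ) :
    2 * Real.cos θ * Real.sin ((k + 1) * θ) - Real.sin (k * θ) = Real.sin ((k + 2) * θ) := by
  rw [show ((k : ℝ) + 2) * θ = (k + 1) * θ + θ by ring,
    show (k : ℝ) * θ = (k + 1) * θ - θ by ring, Real.sin_add, Real.sin_sub]
  ring

/-- The effect of an alternating product of two reflections on the two wall functions. -/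
lemma sin_mul_wallDist_altProd (hσ : IsCoxeterSimplex σ M) {i j : Fin (n + 1)} (hij : i ≠ j)
    (k : ℕ) (x : P) :
    Real.sin (Real.pi / M i j) * wallDist σ i (altProd (facetReflection σ) j i k x) =
      if Even k then Real.sin ((k + 1) * (Real.pi / M i j)) * wallDist σ i x +
        Real.sin (k * (Real.pi / M i j)) * wallDist σ j x
      else Real.sin (k * (Real.pi / M i j)) * wallDist σ i x +
        Real.sin ((k + 1) * (Real.pi / M i j)) * wallDist σ j x := by
  have hstep : ∀ {i j : Fin (n + 1)} (_ : i ≠ j) (y : P),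
      wallDist σ i (facetReflection σ j y) =
        wallDist σ i y + 2 * Real.cos (Real.pi / M i j) * wallDist σ j y := by
    intro i j hij y
    rw [wallDist_facetReflection hσ.span_eq_top, inner_unitNormal hσ hij]
    ring
  have hself : ∀ (i : Fin (n + 1)) (y : P),
      wallDist σ i (facetReflection σ i y) = -wallDist σ i y := by
    intro i y
    rw [wallDist_facetReflection hσ.span_eq_top, inner_unitNormal_self]
    ring
  -- Stripping the outer `j` leaves the wall `j` one letter earlier and the wall `i` two letters
  -- earlier, hence two steps and the exchange of `i` and `j`.
  induction k using Nat.twoStepInduction generalizing i j with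
  | zero => simp [altProd]
  | one =>
    simp only [altProd, mul_one, Nat.not_even_one, if_false, hstep hij, Nat.cast_one, one_mul]
    rw [show (1 + 1) * (Real.pi / (M i j : ℝ)) = 2 * (Real.pi / M i j) by ring, Real.sin_two_mul]
    ring
  | more k ih0 ih1 =>
    have e : altProd (facetReflection σ) j i (k + 2) x =
        facetReflection σ j (altProd (facetReflection σ) i j (k + 1) x) := rfl
    have e' : altProd (facetReflection σ) i j (k + 1) x =
        facetReflection σ i (altProd (facetReflection σ) j i k x) := rfl
    have h0 := ih0 hij
    have h1 := ih1 hij.symm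
    rw [M.symmetric j i] at h1
    have s0 := sin_mul_add_sin k (Real.pi / M i j)
    have s1 := sin_mul_add_sin (k + 1) (Real.pi / M i j)
    rw [e, hstep hij]
    nth_rewrite 1 [e']
    rw [hself, mul_add, mul_left_comm, h1, mul_neg, h0]
    push_cast at s0 s1 ⊢
    rw [show (k : ℝ) + 1 + 1 = k + 2 by ring] at s1 ⊢
    rw [← s0, show (k : ℝ) + 2 + 1 = k + 1 + 2 by ring, ← s1]
    by_cases hk : Even k
    · simp only [hk, Nat.even_add_one, not_true, not_false_iff, if_true, if_false]
      rw [← s0]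
      ring
    · simp only [hk, Nat.even_add_one, not_true, not_false_iff, if_true, if_false]
      rw [← s0]
      ring

lemma sin_pi_div_pos {m : ℕ} (hm : m ≠ 0) (hm1 : m ≠ 1) : 0 < Real.sin (Real.pi / m) := by
  have h2 : (2 : ℝ) ≤ m := by exact_mod_cast (show 2 ≤ m by omega)
  refine Real.sin_pos_of_pos_of_lt_pi (by positivity) ?_
  exact div_lt_self Real.pi_pos (by linarith)

/-- The simple reflections satisfy the relations encoded by the Coxeter matrix. -/
lemma isLiftable_facetReflection (hσ : IsCoxeterSimplex σ M) (hM : ∀ i j, i ≠ j → M i j ≠ 0) :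
    M.IsLiftable (facetReflection σ) := by
  intro i j
  by_cases hij : i = j
  · subst hij
    rw [M.diagonal, pow_one, facetReflection_mul_self]
  have hs := sin_pi_div_pos (hM i j hij) (M.off_diagonal i j hij)
  have hm : (M i j : ℝ) ≠ 0 := Nat.cast_ne_zero.2 (hM i j hij)
  have hi : ∀ {i j : Fin (n + 1)} (_ : i ≠ j) (x : P), wallDist σ i
      (altProd (facetReflection σ) j i (2 * M i j) x) = wallDist σ i x := by
    intro i j hij x
    have hs := sin_pi_div_pos (hM i j hij) (M.off_diagonal i j hij)
    have hm : (M i j : ℝ) ≠ 0 := Nat.cast_ne_zero.2 (hM i j hij)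
    have h := sin_mul_wallDist_altProd hσ hij (2 * M i j) x
    rw [if_pos (even_two_mul _)] at h
    push_cast at h
    rw [show (2 * (M i j : ℝ) + 1) * (Real.pi / M i j) = Real.pi / M i j + 2 * Real.pi by
      field_simp; ring, show 2 * (M i j : ℝ) * (Real.pi / M i j) = 2 * Real.pi by field_simp,
      Real.sin_add_two_pi, Real.sin_two_pi, zero_mul, add_zero] at h
    exact mul_left_cancel₀ hs.ne' h
  -- The displacement lies in the span of the two normals. Since both wall functions turn out to be
  -- preserved, it is also orthogonal to them and must vanish.
  have hspan : ∀ k, ∀ (i j : Fin (n + 1)) (x : P), ∃ a b : ℝ,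
      altProd (facetReflection σ) i j k x = (a • unitNormal σ i + b • unitNormal σ j) +ᵥ x := by
    intro k
    induction k with
    | zero => exact fun i j x => ⟨0, 0, by simp [altProd]⟩
    | succ k ih =>
      intro i j x
      obtain ⟨a, b, h⟩ := ih j i x
      have e : altProd (facetReflection σ) i j (k + 1) x =
        facetReflection σ i (altProd (facetReflection σ) j i k x) := rfl
      rw [e, facetReflection_apply hσ.span_eq_top, h, vadd_vadd]
      set c := -(2 * wallDist σ i ((a • unitNormal σ j + b • unitNormal σ i) +ᵥ x))
      exact ⟨c + b, a, by congr 1; module⟩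
  rw [← altProd_two_mul]
  ext x
  obtain ⟨a, b, h⟩ := hspan (2 * M i j) i j x
  have h1 := hi (Ne.symm hij) x
  have h2 : wallDist σ i (altProd (facetReflection σ) i j (2 * M i j) x) = wallDist σ i x := by
    -- The trigonometric formula treats the wall `i` only for words beginning with `j`. The other
    -- word is the inverse, so it preserves that wall too.
    have hinv : altProd (facetReflection σ) i j (2 * M i j) *
        altProd (facetReflection σ) j i (2 * M i j) = 1 := by
      have hk : facetReflection σ j * facetReflection σ i =
          (facetReflection σ i * facetReflection σ j)⁻¹ := by
        rw [mul_inv_rev, inv_eq_of_mul_eq_one_left (facetReflection_mul_self σ i),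
          inv_eq_of_mul_eq_one_left (facetReflection_mul_self σ j)]
      rw [altProd_two_mul, altProd_two_mul, hk, inv_pow, mul_inv_cancel]
    have hinv' : altProd (facetReflection σ) j i (2 * M i j)
        (altProd (facetReflection σ) i j (2 * M i j) x) = x := by
      have := congrArg (fun g : P ≃ᵃⁱ[ℝ] P => g x) (mul_eq_one_comm.1 hinv)
      exact this
    rw [← hi hij, hinv']
  rw [M.symmetric j i] at h1
  rw [h, wallDist_vadd] at h1 h2
  rw [h]
  set v := a • unitNormal σ i + b • unitNormal σ j with hv
  have hvv : ⟪v, v⟫ = 0 := by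
    conv_lhs => rw [hv]
    rw [inner_add_left, inner_smul_left, inner_smul_left]
    simp only [conj_trivial]
    rw [show ⟪unitNormal σ i, v⟫ = 0 by linarith, show ⟪unitNormal σ j, v⟫ = 0 by linarith]
    ring
  rw [inner_self_eq_zero.1 hvv, zero_vadd]
  rfl

/-- The action of the abstract Coxeter group through the facet reflections. -/
def coxeterAction (hσ : IsCoxeterSimplex σ M) (hM : ∀ i j, i ≠ j → M i j ≠ 0) :
    M.Group →* (P ≃ᵃⁱ[ℝ] P) :=
  M.toCoxeterSystem.lift ⟨facetReflection σ, isLiftable_facetReflection hσ hM⟩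

lemma coxeterAction_simple (hσ : IsCoxeterSimplex σ M) (hM : ∀ i j, i ≠ j → M i j ≠ 0)
    (i : Fin (n + 1)) :
    coxeterAction hσ hM (M.toCoxeterSystem.simple i) = facetReflection σ i :=
  M.toCoxeterSystem.lift_apply_simple (isLiftable_facetReflection hσ hM) i

lemma reflectionGroup_le_range (hσ : IsCoxeterSimplex σ M) (hM : ∀ i j, i ≠ j → M i j ≠ 0) :
    reflectionGroup σ ≤ (coxeterAction hσ hM).range := by
  rw [reflectionGroup, Subgroup.closure_le]
  rintro _ ⟨i, rfl⟩
  exact ⟨_, coxeterAction_simple hσ hM i⟩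

/-- Tits' lemma: an element without a left descent at `i` keeps the open chamber on the positive
side of the `i`-th wall. -/
lemma wallDist_coxeterAction_pos (hσ : IsCoxeterSimplex σ M) (hM : ∀ i j, i ≠ j → M i j ≠ 0)
    {x : P} (hx : ∀ i, 0 < wallDist σ i x) (g : M.Group) (i : Fin (n + 1))
    (hi : ¬ M.toCoxeterSystem.IsLeftDescent g i) : 0 < wallDist σ i (coxeterAction hσ hM g x) := by
  induction hl : M.toCoxeterSystem.length g using Nat.strong_induction_on generalizing g i with
  | _ l ih =>
    subst hl
    by_cases hg : g = 1
    · subst hg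
      rw [map_one]
      exact hx i
    obtain ⟨j, hj⟩ := M.toCoxeterSystem.exists_leftDescent_of_ne_one hg
    have hij : i ≠ j := by
      rintro rfl
      exact hi hj
    have hm := hM i j hij
    -- Induction makes both walls positive after `h`. Since `k + 1 ≤ M i j`, the sine coefficients
    -- of the remaining prefix are nonnegative, and one of them is positive.
    obtain ⟨k, h, hk, hlt, rfl, hhi, hhj⟩ := exists_altProd_mul M.toCoxeterSystem hm hi hj
    have pi_i := ih _ hlt h i hhi rfl
    have pi_j := ih _ hlt h j hhj rfl
    have hs := sin_pi_div_pos hm (M.off_diagonal i j hij)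
    have e : coxeterAction hσ hM (altProd M.toCoxeterSystem.simple j i k * h) x =
        altProd (facetReflection σ) j i k (coxeterAction hσ hM h x) := by
      rw [map_mul, map_altProd]
      have : (coxeterAction hσ hM) ∘ M.toCoxeterSystem.simple = facetReflection σ :=
        funext fun i => coxeterAction_simple hσ hM i
      rw [this]
      rfl
    have key := sin_mul_wallDist_altProd hσ hij k (coxeterAction hσ hM h x)
    have hm0 : (0 : ℝ) < M i j := by exact_mod_cast Nat.pos_of_ne_zero hm
    have hk1 : (k : ℝ) + 1 ≤ M i j := by exact_mod_cast hk
    have hθ : 0 < Real.pi / M i j := div_pos Real.pi_pos hm0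
    have hle : ((k : ℝ) + 1) * (Real.pi / M i j) ≤ Real.pi := by
      calc ((k : ℝ) + 1) * (Real.pi / M i j) ≤ M i j * (Real.pi / M i j) := by gcongr
        _ = Real.pi := by field_simp
    have s1 : 0 ≤ Real.sin ((k + 1) * (Real.pi / M i j)) :=
      Real.sin_nonneg_of_nonneg_of_le_pi (by positivity) hle
    have s0 : 0 ≤ Real.sin (k * (Real.pi / M i j)) :=
      Real.sin_nonneg_of_nonneg_of_le_pi (by positivity) (by nlinarith)
    have hpos : 0 < Real.sin ((k + 1) * (Real.pi / M i j)) ∨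
        0 < Real.sin (k * (Real.pi / M i j)) := by
      rcases Nat.eq_zero_or_pos k with rfl | hk0
      · left
        simpa using hs
      · right
        have : (0 : ℝ) < k := by exact_mod_cast hk0
        exact Real.sin_pos_of_pos_of_lt_pi (by positivity) (by nlinarith)
    rw [e]
    refine pos_of_mul_pos_right (a := Real.sin (Real.pi / M i j)) ?_ hs.le
    rw [key]
    split_ifs <;> rcases hpos with hp | hp <;> positivity

/-- An element of the reflection group that maps an interior point of the fundamental chamber into
the closed fundamental chamber is trivial. -/
lemma eq_one_of_wallDist_nonneg (hσ : IsCoxeterSimplex σ M) (hM : ∀ i j, i ≠ j → M i j ≠ 0)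
    {x : P} (hx : ∀ i, 0 < wallDist σ i x) {g : P ≃ᵃⁱ[ℝ] P} (hg : g ∈ reflectionGroup σ)
    (hgx : ∀ i, 0 ≤ wallDist σ i (g x)) : g = 1 := by
  obtain ⟨h, rfl⟩ := reflectionGroup_le_range hσ hM hg
  by_cases h1 : h = 1
  · rw [h1, map_one]
  obtain ⟨i, hi⟩ := M.toCoxeterSystem.exists_leftDescent_of_ne_one h1
  -- Removing the left descent `i` and applying Tits' lemma puts the image of `x` strictly on the
  -- negative side of wall `i`.
  have := wallDist_coxeterAction_pos hσ hM hx _ i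
    ((M.toCoxeterSystem.isLeftDescent_iff_not_isLeftDescent_mul).1 hi)
  rw [map_mul, coxeterAction_simple] at this
  have e : (facetReflection σ i * coxeterAction hσ hM h) x =
    facetReflection σ i (coxeterAction hσ hM h x) := rfl
  rw [e, wallDist_facetReflection hσ.span_eq_top, inner_unitNormal_self] at this
  have := hgx i
  linarith

/-- A chamber whose closure meets the interior of another chamber is equal to it. -/
lemma IsChamber.eq_of_wallDist (hσ : IsCoxeterSimplex σ M) (hM : ∀ i j, i ≠ j → M i j ≠ 0)
    {τ τ' : Simplex ℝ P n} (hτ : IsChamber σ τ) (hτ' : IsChamber σ τ') {x : P}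
    (hx : ∀ i, 0 < wallDist τ i x) (hx' : ∀ i, 0 ≤ wallDist τ' i x) : τ = τ' := by
  obtain ⟨g, hg, rfl⟩ := isChamber_iff.1 hτ
  obtain ⟨g', hg', rfl⟩ := isChamber_iff.1 hτ'
  obtain ⟨y, rfl⟩ := g.surjective x
  simp_rw [wallDist_imageSimplex] at hx
  have e : g y = g' ((g'⁻¹ * g) y) := by
    simp [AffineIsometryEquiv.coe_mul, AffineIsometryEquiv.coe_inv]
  rw [e] at hx'
  simp_rw [wallDist_imageSimplex] at hx'
  have := eq_one_of_wallDist_nonneg hσ hM hx (mul_mem (inv_mem hg') hg) hx'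
  rw [inv_mul_eq_one.1 this]

end Tits

/-! ### The diagram is a forest outside type `Ã`. -/

section Diagram

variable {V P : Type*} [NormedAddCommGroup V] [InnerProductSpace ℝ V] [MetricSpace P]
  [NormedAddTorsor V P] {n : ℕ} [NeZero n] {σ : Simplex ℝ P n} {M : CoxeterMatrix (Fin (n + 1))}

/-- Two facets with parallel hyperplanes are the only facets of the simplex. -/
lemma eq_one_of_entry_eq_zero (hσ : IsCoxeterSimplex σ M) {i j : Fin (n + 1)} (hij : i ≠ j)
    (h : M i j = 0) : n = 1 := by
  have hin := inner_unitNormal hσ hij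
  rw [h, Nat.cast_zero, div_zero, Real.cos_zero] at hin
  have hsum : unitNormal σ i + unitNormal σ j = 0 := by
    rw [← inner_self_eq_zero (𝕜 := ℝ), real_inner_add_add_self, inner_unitNormal_self,
      inner_unitNormal_self, hin]
    norm_num
  by_contra hn
  have hn2 : 2 < n + 1 := by have := NeZero.pos n; omega
  obtain ⟨k, hki, hkj⟩ := Fin.exists_ne_and_ne_of_two_lt i j hn2
  -- A relation supported on `i` and `j` alone, although every nontrivial relation also involves the
  -- third facet `k`.
  have hd : ∑ l, ((if l = i then 1 else 0) + if l = j then 1 else 0 : ℝ) • unitNormal σ l = 0 := by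
    simp_rw [add_smul, Finset.sum_add_distrib, ite_smul, one_smul, zero_smul,
      Finset.sum_ite_eq', Finset.mem_univ, if_true]
    exact hsum
  obtain ⟨μ, hμ⟩ := eq_smul_of_sum_smul_unitNormal_eq_zero σ hd
  have h0 := hμ k
  have h1 := hμ i
  have hk := (inv_pos.2 (σ.height_pos k)).ne'
  simp only [hki, hkj, hij, if_true, if_false, add_zero] at h0 h1
  rcases mul_eq_zero.1 h0.symm with h2 | h2
  · rw [h2, zero_mul] at h1
    exact one_ne_zero h1
  · exact hk h2

/-- The two heights of a segment agree, so its normals are opposite and `cos (π / m) = 1`. This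
forces the entry `0`, which encodes `m = ∞`. -/
lemma isTypeA_of_eq_one (hσ : IsCoxeterSimplex σ M) (hn : n = 1) : IsTypeA M := by
  subst hn
  have h01 : M 0 1 = 0 := by
    have hin := inner_unitNormal hσ (zero_ne_one' (Fin 2))
    have hs := sum_smul_unitNormal hσ.span_eq_top
    rw [Fin.sum_univ_two, Simplex.height_eq_dist, Simplex.height_eq_dist, ← smul_add] at hs
    have hd : (dist (σ.points 0) (σ.points 1))⁻¹ ≠ 0 := by
      have := σ.height_pos 0
      rw [Simplex.height_eq_dist] at this
      exact inv_ne_zero this.ne'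
    have hs := (smul_eq_zero.1 hs).resolve_left hd
    rw [eq_neg_of_add_eq_zero_left hs, inner_neg_left, inner_unitNormal_self, neg_inj] at hin
    by_contra hne
    have h2 : (2 : ℝ) ≤ M 0 1 := by
      have := M.off_diagonal 0 1 (zero_ne_one' (Fin 2))
      exact_mod_cast (show 2 ≤ M 0 1 by omega)
    have hpos : 0 < Real.pi / M 0 1 := div_pos Real.pi_pos (by linarith)
    have hlt : Real.pi / M 0 1 < Real.pi := div_lt_self Real.pi_pos (by linarith)
    have := Real.cos_lt_cos_of_nonneg_of_le_pi le_rfl hlt.le hpos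
    rw [Real.cos_zero] at this
    linarith
  refine ⟨Equiv.refl _, ?_⟩
  ext i j
  rw [CoxeterMatrix.reindex_apply]
  fin_cases i <;> fin_cases j
  · exact M.diagonal 0
  · exact h01
  · exact (M.symmetric 1 0).trans h01
  · exact M.diagonal 1

lemma entry_ne_zero (hA : ¬ IsTypeA M) (hσ : IsCoxeterSimplex σ M) (i j : Fin (n + 1))
    (hij : i ≠ j) : M i j ≠ 0 := fun h =>
  hA (isTypeA_of_eq_one hσ (eq_one_of_entry_eq_zero hσ hij h))

lemma cos_pi_div_nonneg {m : ℕ} (hm : 2 ≤ m) : 0 ≤ Real.cos (Real.pi / m) := by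
  have h2 : (2 : ℝ) ≤ m := by exact_mod_cast hm
  have hpos : 0 < Real.pi / m := div_pos Real.pi_pos (by linarith)
  refine Real.cos_nonneg_of_neg_pi_div_two_le_of_le (by linarith [Real.pi_pos]) ?_
  gcongr

lemma half_le_cos_pi_div {m : ℕ} (hm : 3 ≤ m) : 1 / 2 ≤ Real.cos (Real.pi / m) := by
  have h2 : (3 : ℝ) ≤ m := by exact_mod_cast hm
  have hpos : 0 < Real.pi / m := div_pos Real.pi_pos (by linarith)
  rw [← Real.cos_pi_div_three]
  refine Real.cos_le_cos_of_nonneg_of_le_pi hpos.le (by linarith [Real.pi_pos]) ?_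
  gcongr

lemma eq_of_cos_pi_div_eq {m k : ℕ} (hm : 2 ≤ m) (hk : 2 ≤ k)
    (h : Real.cos (Real.pi / m) = Real.cos (Real.pi / k)) : m = k := by
  have h2 : (2 : ℝ) ≤ m := by exact_mod_cast hm
  have h2' : (2 : ℝ) ≤ k := by exact_mod_cast hk
  have hp := Real.pi_pos
  have := Real.injOn_cos ⟨by positivity, div_le_self hp.le (by linarith)⟩
    ⟨by positivity, div_le_self hp.le (by linarith)⟩ h
  rw [div_eq_div_iff (by positivity) (by positivity)] at this
  exact_mod_cast (mul_left_cancel₀ hp.ne' this).symm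

/-- The Gram matrix of the simplex of type `Ã_k`. -/
def cycleGram (k : ℕ) (i j : Fin (k + 1)) : ℝ :=
  if i = j then 1 else if j = i + 1 ∨ i = j + 1 then -(1 / 2) else 0

/-- Two neighbours contribute `-1/2` each; `2 ≤ k` keeps `i`, `i + 1` and `i - 1` distinct. -/
lemma sum_cycleGram {k : ℕ} (hk : 2 ≤ k) (i : Fin (k + 1)) : ∑ j, cycleGram k i j = 0 := by
  obtain ⟨m, rfl⟩ := Nat.exists_eq_add_of_le' hk
  have h1 : (1 : Fin (m + 2 + 1)) ≠ 0 := one_ne_zero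
  have h2 : (1 + 1 : Fin (m + 2 + 1)) ≠ 0 := by
    rw [Ne, Fin.ext_iff, Fin.val_add, Fin.val_one, Fin.val_zero, Nat.mod_eq_of_lt (by omega)]
    omega
  have e : ∀ j, cycleGram (m + 2) i j = (if j = i then 1 else 0) + (if j = i + 1 then -(1 / 2) else 0) +
      (if j = i - 1 then -(1 / 2) else 0) := by
    intro j
    have a1 : i ≠ i + 1 := fun h => h1 (left_eq_add.1 h)
    have a2 : i ≠ i - 1 := fun h => h1 (sub_eq_self.1 h.symm)
    have a3 : i + 1 ≠ i - 1 := fun h => h2 (by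
      have := congrArg (· - i + 1) h
      simpa [add_assoc] using this)
    have a4 : i = j + 1 ↔ j = i - 1 := by rw [eq_sub_iff_add_eq, eq_comm]
    simp only [cycleGram, a4]
    by_cases b0 : j = i
    · subst b0
      simp [a1, a2]
    · by_cases b1 : j = i + 1
      · subst b1
        simp [a1, a3, h1]
      · simp [b0, b1, Ne.symm b0]
  simp_rw [e, Finset.sum_add_distrib, Finset.sum_ite_eq', Finset.mem_univ, if_true]
  norm_num

/-- The diagram of a euclidean Coxeter simplex is a forest unless it is of type `Ã`. -/
lemma isAcyclic_diagram (hA : ¬ IsTypeA M) (hσ : IsCoxeterSimplex σ M) :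
    (diagram M).IsAcyclic := by
  by_contra hcyc
  rw [SimpleGraph.isAcyclic_iff_free_cycleGraph] at hcyc
  push Not at hcyc
  obtain ⟨l, hl, hfree⟩ := hcyc
  obtain ⟨k, rfl⟩ := Nat.exists_eq_succ_of_ne_zero (show l ≠ 0 by omega)
  obtain ⟨⟨φ, hφ⟩⟩ := hfree
  have hk : 2 ≤ k := by omega
  have hM := entry_ne_zero hA hσ
  have hM2 : ∀ i j, i ≠ j → 2 ≤ M i j := fun i j hij => by
    have := hM i j hij
    have := M.off_diagonal i j hij
    omega
  have hadj : ∀ {i j : Fin (k + 1)}, i ≠ j → (j = i + 1 ∨ i = j + 1) → 3 ≤ M (φ i) (φ j) := by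
    intro i j hij h
    have hc : (SimpleGraph.cycleGraph (k + 1)).Adj i j := by
      rw [SimpleGraph.cycleGraph_eq_circulantGraph, SimpleGraph.circulantGraph_adj]
      refine ⟨hij, ?_⟩
      rcases h with h | h <;> simp [h]
    have hne := (φ.map_adj hc).2
    have := hM2 _ _ (hφ.ne hij)
    omega
  -- The copy of the cycle need not be induced: chords and labels above 3 only lower the Gram
  -- entries.
  have hle : ∀ i j, ⟪unitNormal σ (φ i), unitNormal σ (φ j)⟫ ≤ cycleGram k i j := by
    intro i j
    by_cases hij : i = j
    · subst hij
      rw [inner_unitNormal_self, cycleGram, if_pos rfl]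
    · rw [inner_unitNormal hσ (hφ.ne hij), cycleGram, if_neg hij]
      split_ifs with h
      · exact neg_le_neg (half_le_cos_pi_div (hadj hij h))
      · exact neg_nonpos.2 (cos_pi_div_nonneg (hM2 _ _ (hφ.ne hij)))
  set v := ∑ i, unitNormal σ (φ i) with hv
  have hvv : ⟪v, v⟫ = ∑ i, ∑ j, ⟪unitNormal σ (φ i), unitNormal σ (φ j)⟫ := by
    simp_rw [hv, sum_inner, inner_sum]
  have hnn : 0 ≤ ⟪v, v⟫ := real_inner_self_nonneg
  have hrow : ∀ i, ∑ j, ⟪unitNormal σ (φ i), unitNormal σ (φ j)⟫ ≤ 0 := fun i =>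
    (Finset.sum_le_sum fun j _ => hle i j).trans_eq (sum_cycleGram hk i)
  have hzero : ⟪v, v⟫ = 0 := le_antisymm (hvv ▸ Finset.sum_nonpos fun i _ => hrow i) hnn
  have hroweq : ∀ i, ∑ j, ⟪unitNormal σ (φ i), unitNormal σ (φ j)⟫ = 0 := fun i =>
    (Finset.sum_eq_zero_iff_of_nonpos fun i _ => hrow i).1 (hvv ▸ hzero) i (Finset.mem_univ i)
  have heq : ∀ i j, ⟪unitNormal σ (φ i), unitNormal σ (φ j)⟫ = cycleGram k i j := fun i j =>
    (Finset.sum_eq_sum_iff_of_le fun j _ => hle i j).1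
      ((hroweq i).trans (sum_cycleGram hk i).symm) j (Finset.mem_univ j)
  -- The indicator function of the cycle gives a relation among the normals, and a nontrivial
  -- relation has full support.
  have hsurj : Function.Surjective φ := by
    have hd : ∑ l, (if l ∈ Set.range φ then 1 else 0 : ℝ) • unitNormal σ l = 0 := by
      classical
      rw [← inner_self_eq_zero.1 hzero, hv]
      simp_rw [ite_smul, one_smul, zero_smul]
      rw [← Finset.sum_filter, ← Finset.sum_image (g := φ) (s := Finset.univ)
        (f := fun l => unitNormal σ l) hφ.injOn]
      congr 1
      ext l
      simp
    obtain ⟨μ, hμ⟩ := eq_smul_of_sum_smul_unitNormal_eq_zero σ hd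
    have h0 := hμ (φ 0)
    rw [if_pos ⟨0, rfl⟩] at h0
    intro l
    by_contra hl
    have h1 := hμ l
    rw [if_neg (show l ∉ Set.range φ from hl)] at h1
    rcases mul_eq_zero.1 h1.symm with h2 | h2
    · rw [h2, zero_mul] at h0
      exact one_ne_zero h0
    · exact (inv_pos.2 (σ.height_pos l)).ne' h2
  have hkn : k = n := by
    have := Fintype.card_of_bijective ⟨hφ, hsurj⟩
    simpa using this
  subst hkn
  apply hA
  refine ⟨(Equiv.ofBijective φ ⟨hφ, hsurj⟩).symm, ?_⟩
  ext i j
  rw [CoxeterMatrix.reindex_apply]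
  change M (φ i) (φ j) =
    if i = j then 1 else if k = 1 then 0 else if j = i + 1 ∨ i = j + 1 then 3 else 2
  have hG := heq i j
  by_cases hij : i = j
  · subst hij
    simp
  rw [inner_unitNormal hσ (hφ.ne hij), cycleGram, if_neg hij] at hG
  rw [if_neg hij, if_neg (by omega)]
  split_ifs at hG ⊢ with h
  · refine eq_of_cos_pi_div_eq (hM2 _ _ (hφ.ne hij)) (by norm_num) ?_
    rw [Nat.cast_ofNat, Real.cos_pi_div_three]
    linarith
  · refine eq_of_cos_pi_div_eq (hM2 _ _ (hφ.ne hij)) le_rfl ?_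
    rw [Nat.cast_ofNat, Real.cos_pi_div_two]
    linarith

end Diagram

/-! ### Products over a forest in different orders are conjugate. -/

section Conjugacy

/-- A nonempty finite set of vertices of a forest contains a vertex with at most one neighbour in
that set. -/
lemma exists_leaf {ι : Type*} {Γ : SimpleGraph ι} (hΓ : Γ.IsAcyclic) {S : Finset ι}
    (hS : S.Nonempty) :
    ∃ v ∈ S, ∀ x ∈ S, ∀ y ∈ S, Γ.Adj v x → Γ.Adj v y → x = y := by
  classical
  obtain ⟨v₀, hv₀⟩ := hS
  by_cases hnt : Nontrivial S
  · have : Nonempty S := ⟨⟨v₀, hv₀⟩⟩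
    obtain ⟨T, hT, -, htree⟩ := SimpleGraph.connected_top
      |>.exists_isTree_le_of_le_of_isAcyclic (V := S) le_top (hΓ.induce (S : Set ι))
    obtain ⟨v, hv⟩ := htree.exists_vert_degree_one_of_nontrivial
    obtain ⟨u, -, hu⟩ := SimpleGraph.degree_eq_one_iff_existsUnique_adj.1 hv
    refine ⟨v, v.2, fun x hx y hy hvx hvy => ?_⟩
    have h1 := hu ⟨x, hx⟩ (hT (show (Γ.induce (S : Set ι)).Adj v ⟨x, hx⟩ from hvx))
    have h2 := hu ⟨y, hy⟩ (hT (show (Γ.induce (S : Set ι)).Adj v ⟨y, hy⟩ from hvy))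
    exact congrArg Subtype.val (h1.trans h2.symm)
  · rw [not_nontrivial_iff_subsingleton] at hnt
    exact ⟨v₀, hv₀, fun x hx y hy _ _ =>
      congrArg Subtype.val (Subsingleton.elim (⟨x, hx⟩ : S) ⟨y, hy⟩)⟩

variable {ι G : Type*} [Group G]

lemma commute_list_prod {s : ι → G} {a : G} {L : List ι} (h : ∀ x ∈ L, Commute a (s x)) :
    Commute a (L.map s).prod := by
  refine Commute.list_prod_right _ _ fun y hy => ?_
  obtain ⟨x, hx, rfl⟩ := List.mem_map.1 hy
  exact h x hx

lemma prod_map_update_of_notMem [DecidableEq ι] (s : ι → G) {u : ι} (a : G) {L : List ι}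
    (h : u ∉ L) : (L.map (Function.update s u a)).prod = (L.map s).prod := by
  congr 1
  refine List.map_congr_left fun x hx => Function.update_of_ne ?_ _ _
  rintro rfl
  exact h hx

/-- Absorbing a leaf `v` into its neighbour `u` changes a product only by a conjugation. -/
lemma exists_conj_erase [DecidableEq ι] {s : ι → G} {L : List ι} (hL : L.Nodup) {u v : ι}
    (hu : u ∈ L) (hv : v ∈ L) (huv : u ≠ v)
    (hc : ∀ x ∈ L, x ≠ u → Commute (s v) (s x)) (H : Subgroup G) (hH : s v ∈ H) :
    ∃ h ∈ H, (L.map s).prod =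
      h * ((L.erase v).map (Function.update s u (s u * s v))).prod * h⁻¹ := by
  obtain ⟨A, B, rfl⟩ := List.append_of_mem hv
  have hvA : v ∉ A := fun h => (List.nodup_append.1 hL).2.2 v h v (by simp) rfl
  rw [List.erase_append_right _ hvA, List.erase_cons_head]
  have hu' : u ∈ A ∨ u ∈ B := by simpa [huv] using hu
  rcases hu' with hA | hB
  · obtain ⟨A₁, A₂, rfl⟩ := List.append_of_mem hA
    refine ⟨1, one_mem _, ?_⟩
    have hnd : u ∉ A₁ ∧ u ∉ A₂ ∧ u ∉ B := by
      simp only [List.append_assoc, List.cons_append, List.nodup_append, List.nodup_cons,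
        List.mem_append, List.mem_cons] at hL
      grind
    have hcA : Commute (s v) (A₂.map s).prod := commute_list_prod fun x hx =>
      hc x (by simp [hx]) (by rintro rfl; exact hnd.2.1 hx)
    simp only [List.map_append, List.map_cons, List.prod_append, List.prod_cons,
      prod_map_update_of_notMem s _ hnd.1, prod_map_update_of_notMem s _ hnd.2.1,
      prod_map_update_of_notMem s _ hnd.2.2, Function.update_self, one_mul, inv_one, mul_one,
      mul_assoc]
    congr 2
    rw [← mul_assoc, ← mul_assoc, hcA.eq]
  · obtain ⟨B₁, B₂, rfl⟩ := List.append_of_mem hB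
    -- Here `v` precedes `u`. The factor `s v` moves left past `A` to the front, and conjugation
    -- brings it round from the right end past `B₂` to `u`.
    refine ⟨s v, hH, ?_⟩
    have hnd : u ∉ A ∧ u ∉ B₁ ∧ u ∉ B₂ := by
      simp only [List.nodup_append, List.nodup_cons, List.mem_append, List.mem_cons] at hL
      grind
    have hcA : Commute (s v) (A.map s).prod := commute_list_prod fun x hx =>
      hc x (by simp [hx]) (by rintro rfl; exact hnd.1 hx)
    have hcB : Commute (s v) (B₂.map s).prod := commute_list_prod fun x hx =>
      hc x (by simp [hx]) (by rintro rfl; exact hnd.2.2 hx)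
    simp only [List.map_append, List.map_cons, List.prod_append, List.prod_cons,
      prod_map_update_of_notMem s _ hnd.1, prod_map_update_of_notMem s _ hnd.2.1,
      prod_map_update_of_notMem s _ hnd.2.2, Function.update_self]
    rw [← mul_assoc, ← hcA.eq, mul_assoc (s u), hcB.eq]
    group

/-- If the non-commutation graph of a finite family in a group is a forest, then the products of
the family in any two orders are conjugate. -/
lemma exists_conj_of_perm {Γ : SimpleGraph ι} (hΓ : Γ.IsAcyclic) (L L' : List ι) (s : ι → G)
    (H : Subgroup G) (hL : L.Nodup) (hLL' : L.Perm L') (hH : ∀ x ∈ L, s x ∈ H)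
    (hc : ∀ x ∈ L, ∀ y ∈ L, x ≠ y → ¬ Γ.Adj x y → Commute (s x) (s y)) :
    ∃ g ∈ H, (L'.map s).prod = g * (L.map s).prod * g⁻¹ := by
  classical
  -- The family `s` varies because merging a leaf replaces `s u` by `s u * s v`, and `H` varies to
  -- control the conjugating element.
  induction hl : L.length generalizing L L' s H with
  | zero =>
    rw [List.length_eq_zero_iff.1 hl] at hLL' ⊢
    rw [hLL'.symm.eq_nil]
    exact ⟨1, one_mem _, by simp⟩
  | succ l ih =>
    have hne : L.toFinset.Nonempty := by
      rw [List.toFinset_nonempty_iff]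
      rintro rfl
      simp at hl
    obtain ⟨v, hv, hleaf⟩ := exists_leaf hΓ hne
    rw [List.mem_toFinset] at hv
    have hv' := hLL'.mem_iff.1 hv
    have hL' := hLL'.nodup_iff.1 hL
    have hlen : (L.erase v).length = l := by
      rw [List.length_erase_of_mem hv, hl, Nat.add_sub_cancel]
    have hmem : ∀ {x}, x ∈ L.erase v → x ∈ L := fun h => List.mem_of_mem_erase h
    by_cases hnb : ∃ u ∈ L, Γ.Adj v u
    · obtain ⟨u, hu, hadj⟩ := hnb
      have hcv : ∀ x ∈ L, x ≠ u → Commute (s v) (s x) := by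
        intro x hx hxu
        by_cases hxv : v = x
        · rw [hxv]
        · refine hc v hv x hx hxv fun h => hxu ?_
          exact hleaf x (List.mem_toFinset.2 hx) u (List.mem_toFinset.2 hu) h hadj
      obtain ⟨h, hhH, hh⟩ := exists_conj_erase hL hu hv hadj.ne' hcv H (hH v hv)
      obtain ⟨h', hhH', hh'⟩ := exists_conj_erase hL' (hLL'.mem_iff.1 hu) hv' hadj.ne'
        (fun x hx => hcv x (hLL'.mem_iff.2 hx)) H (hH v hv)
      obtain ⟨g, hg, hgg⟩ := ih (L.erase v) (L'.erase v) (Function.update s u (s u * s v)) H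
        (hL.erase v) (hLL'.erase v) (fun x hx => by
          by_cases hxu : x = u
          · subst hxu
            rw [Function.update_self]
            exact mul_mem (hH _ hu) (hH v hv)
          · rw [Function.update_of_ne hxu]
            exact hH x (hmem hx))
        (fun x hx y hy hxy hnadj => by
          have hcs := hc x (hmem hx) y (hmem hy) hxy hnadj
          by_cases hxu : x = u
          · subst hxu
            rw [Function.update_self, Function.update_of_ne hxy.symm]
            exact hcs.mul_left (hcv y (hmem hy) hxy.symm)
          · rw [Function.update_of_ne hxu]
            by_cases hyu : y = u
            · subst hyu
              rw [Function.update_self]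
              exact hcs.mul_right (hcv x (hmem hx) hxu).symm
            · rwa [Function.update_of_ne hyu]) hlen
      refine ⟨h' * g * h⁻¹, mul_mem (mul_mem hhH' hg) (inv_mem hhH), ?_⟩
      rw [hh', hgg, hh]
      group
    · push Not at hnb
      have hcv : ∀ x ∈ L, Commute (s v) (s x) := by
        intro x hx
        by_cases hxv : v = x
        · rw [hxv]
        · exact hc v hv x hx hxv (hnb x hx)
      have hprod : ∀ K : List ι, v ∈ K → (∀ x ∈ K, x ∈ L) →
          (K.map s).prod = s v * ((K.erase v).map s).prod := by
        intro K hK hKL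
        obtain ⟨A, B, -, rfl, he⟩ := List.exists_erase_eq hK
        have hcA : Commute (s v) (A.map s).prod := commute_list_prod fun x hx =>
          hcv x (hKL x (by simp [hx]))
        rw [he]
        simp only [List.map_append, List.map_cons, List.prod_append, List.prod_cons]
        rw [← mul_assoc, ← mul_assoc, hcA.eq]
      -- All remaining factors commute with `s v`, so the conjugating element can be kept in its
      -- centralizer.
      obtain ⟨g, hg, hgg⟩ := ih (L.erase v) (L'.erase v) s (H ⊓ Subgroup.centralizer {s v})
        (hL.erase v) (hLL'.erase v)
        (fun x hx => ⟨hH x (hmem hx), Subgroup.mem_centralizer_singleton_iff.2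
          (hcv x (hmem hx)).symm.eq⟩)
        (fun x hx y hy => hc x (hmem hx) y (hmem hy)) hlen
      refine ⟨g, hg.1, ?_⟩
      have hcg : g * s v = s v * g := Subgroup.mem_centralizer_singleton_iff.1 hg.2
      rw [hprod L' hv' (fun x hx => hLL'.mem_iff.2 hx), hprod L hv (fun x hx => hx), hgg,
        ← mul_assoc, ← mul_assoc, ← mul_assoc, hcg]

end Conjugacy

/-! ### Commuting facet reflections and conjugate Coxeter elements. -/

section Bipartite

variable {V P : Type*} [NormedAddCommGroup V] [InnerProductSpace ℝ V] [MetricSpace P]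
  [NormedAddTorsor V P] {n : ℕ} [NeZero n] {σ : Simplex ℝ P n} {M : CoxeterMatrix (Fin (n + 1))}

lemma inner_unitNormal_of_not_adj (hσ : IsCoxeterSimplex σ M) {i j : Fin (n + 1)} (hij : i ≠ j)
    (h : ¬ (diagram M).Adj i j) : ⟪unitNormal σ i, unitNormal σ j⟫ = 0 := by
  have : M i j = 2 := by
    by_contra h2
    exact h ⟨hij, h2⟩
  rw [inner_unitNormal hσ hij, this, Nat.cast_ofNat, Real.cos_pi_div_two, neg_zero]

lemma commute_facetReflection (hσ : IsCoxeterSimplex σ M) {i j : Fin (n + 1)}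
    (h : ¬ (diagram M).Adj i j) : Commute (facetReflection σ i) (facetReflection σ j) := by
  by_cases hij : i = j
  · rw [hij]
  have h0 := inner_unitNormal_of_not_adj hσ hij h
  ext x
  change facetReflection σ i (facetReflection σ j x) = facetReflection σ j (facetReflection σ i x)
  rw [facetReflection_apply hσ.span_eq_top i (facetReflection σ j x),
    facetReflection_apply hσ.span_eq_top j (facetReflection σ i x),
    wallDist_facetReflection hσ.span_eq_top, wallDist_facetReflection hσ.span_eq_top,
    real_inner_comm (unitNormal σ i), h0, facetReflection_apply hσ.span_eq_top j,
    facetReflection_apply hσ.span_eq_top i, vadd_vadd, vadd_vadd, add_comm]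
  simp

/-- Products of the reflections of a chamber of a forest type in any two orders are conjugate. -/
lemma exists_conj_orderedProduct (hσ : IsCoxeterSimplex σ M) (hΓ : (diagram M).IsAcyclic)
    (e e' : Equiv.Perm (Fin (n + 1))) :
    ∃ g ∈ reflectionGroup σ, orderedProduct σ e' = g * orderedProduct σ e * g⁻¹ := by
  have hp : (List.ofFn e).Perm (List.ofFn e') := by
    refine (List.perm_ext_iff_of_nodup (List.nodup_ofFn.2 e.injective)
      (List.nodup_ofFn.2 e'.injective)).2 fun x => ?_
    exact iff_of_true (List.mem_ofFn.2 (e.surjective x)) (List.mem_ofFn.2 (e'.surjective x))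
  obtain ⟨g, hg, h⟩ := exists_conj_of_perm hΓ (List.ofFn e) (List.ofFn e') (facetReflection σ)
    (reflectionGroup σ) (List.nodup_ofFn.2 e.injective) hp (fun x _ => facetReflection_mem σ x)
    (fun x _ y _ _ h => commute_facetReflection hσ h)
  rw [List.map_ofFn, List.map_ofFn] at h
  exact ⟨g, hg, h⟩

end Bipartite

/-! ### The axis of a bipartite Coxeter element. -/

section Axis

variable {V P : Type*} [NormedAddCommGroup V] [InnerProductSpace ℝ V] [MetricSpace P]
  [NormedAddTorsor V P] {n : ℕ} [NeZero n] {σ : Simplex ℝ P n}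

/-- The unit normals of the facets in `A` are pairwise orthogonal. -/
def PairwiseOrthogonal (σ : Simplex ℝ P n) (A : Finset (Fin (n + 1))) : Prop :=
  ∀ i ∈ A, ∀ j ∈ A, i ≠ j → ⟪unitNormal σ i, unitNormal σ j⟫ = 0

lemma wallDist_sum_smul_vadd (σ : Simplex ℝ P n) (i : Fin (n + 1)) (A : Finset (Fin (n + 1)))
    (d : Fin (n + 1) → ℝ) (r : ℝ) (x : P) :
    wallDist σ i (r • ∑ j ∈ A, d j • unitNormal σ j +ᵥ x) =
      r * ∑ j ∈ A, d j * ⟪unitNormal σ i, unitNormal σ j⟫ + wallDist σ i x := by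
  rw [wallDist_vadd, inner_smul_right, inner_sum]
  simp_rw [inner_smul_right]

lemma PairwiseOrthogonal.sum_mul_inner {A : Finset (Fin (n + 1))} (hA : PairwiseOrthogonal σ A)
    {i : Fin (n + 1)} (hi : i ∈ A) (d : Fin (n + 1) → ℝ) :
    ∑ j ∈ A, d j * ⟪unitNormal σ i, unitNormal σ j⟫ = d i := by
  rw [Finset.sum_eq_single_of_mem i hi, inner_unitNormal_self, mul_one]
  intro j hj hji
  rw [hA i hi j hj hji.symm, mul_zero]

/-- Reflections in orthogonal walls do not change each other's wall functions, so their
displacements add. -/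
lemma prod_map_facetReflection_apply (hσ : affineSpan ℝ (Set.range σ.points) = ⊤)
    {L : List (Fin (n + 1))} (hL : L.Nodup) (hA : PairwiseOrthogonal σ L.toFinset) (x : P) :
    (L.map (facetReflection σ)).prod x =
      (-2 : ℝ) • ∑ i ∈ L.toFinset, wallDist σ i x • unitNormal σ i +ᵥ x := by
  induction L with
  | nil => simp
  | cons i L ih =>
    obtain ⟨hi, hL⟩ := List.nodup_cons.1 hL
    have hi' : i ∉ L.toFinset := fun h => hi (List.mem_toFinset.1 h)
    have hA' : PairwiseOrthogonal σ L.toFinset := fun j hj k hk =>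
      hA j (by simp_all) k (by simp_all)
    rw [List.map_cons, List.prod_cons, AffineIsometryEquiv.coe_mul, Function.comp_apply,
      facetReflection_apply hσ, ih hL hA', wallDist_sum_smul_vadd, List.toFinset_cons,
      Finset.sum_insert hi', Finset.sum_eq_zero, vadd_vadd, smul_add, smul_smul]
    · simp
    · intro j hj
      rw [hA i (by simp) j (by simp_all) (fun h => hi' (h ▸ hj)), mul_zero]

/-- The product of the reflections in the facets in `A`, which commute in the cases of interest. -/
def partReflection (σ : Simplex ℝ P n) (A : Finset (Fin (n + 1))) : P ≃ᵃⁱ[ℝ] P :=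
  (A.toList.map (facetReflection σ)).prod

lemma partReflection_apply (hσ : affineSpan ℝ (Set.range σ.points) = ⊤)
    {A : Finset (Fin (n + 1))} (hA : PairwiseOrthogonal σ A) (x : P) :
    partReflection σ A x = (-2 : ℝ) • ∑ i ∈ A, wallDist σ i x • unitNormal σ i +ᵥ x := by
  have := prod_map_facetReflection_apply hσ (L := A.toList) A.nodup_toList
    (by rwa [Finset.toList_toFinset]) x
  rwa [Finset.toList_toFinset] at this

lemma partReflection_mem (σ : Simplex ℝ P n) (A : Finset (Fin (n + 1))) :
    partReflection σ A ∈ reflectionGroup σ := by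
  refine Subgroup.list_prod_mem _ fun g hg => ?_
  obtain ⟨i, -, rfl⟩ := List.mem_map.1 hg
  exact facetReflection_mem σ i

lemma partReflection_mul_self (hσ : affineSpan ℝ (Set.range σ.points) = ⊤)
    {A : Finset (Fin (n + 1))} (hA : PairwiseOrthogonal σ A) :
    partReflection σ A * partReflection σ A = 1 := by
  ext x
  change partReflection σ A (partReflection σ A x) = x
  rw [partReflection_apply hσ hA (partReflection σ A x)]
  have : ∑ i ∈ A, wallDist σ i (partReflection σ A x) • unitNormal σ i =
      -∑ i ∈ A, wallDist σ i x • unitNormal σ i := by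
    rw [← Finset.sum_neg_distrib]
    refine Finset.sum_congr rfl fun i hi => ?_
    rw [partReflection_apply hσ hA, wallDist_sum_smul_vadd, hA.sum_mul_inner hi]
    module
  rw [this, partReflection_apply hσ hA, vadd_vadd, smul_neg, neg_add_cancel, zero_vadd]

/-- The direction of the axis of the bipartite Coxeter element belonging to the part `A`. -/
def axisDirection (σ : Simplex ℝ P n) (A : Finset (Fin (n + 1))) : V :=
  ∑ i ∈ A, (σ.height i)⁻¹ • unitNormal σ i

lemma axisDirection_compl (hσ : affineSpan ℝ (Set.range σ.points) = ⊤)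
    (A : Finset (Fin (n + 1))) : axisDirection σ Aᶜ = -axisDirection σ A := by
  rw [eq_neg_iff_add_eq_zero, add_comm, axisDirection, axisDirection, Finset.sum_add_sum_compl]
  exact sum_smul_unitNormal hσ

/-- The width of the simplex along the axis, in the parametrization of the axis used below. -/
def axisWidth (σ : Simplex ℝ P n) (A : Finset (Fin (n + 1))) : ℝ :=
  (∑ i ∈ A, ((σ.height i)⁻¹) ^ 2)⁻¹

lemma inner_axisDirection_of_mem {A : Finset (Fin (n + 1))} (hA : PairwiseOrthogonal σ A)
    {i : Fin (n + 1)} (hi : i ∈ A) :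
    ⟪unitNormal σ i, axisDirection σ A⟫ = (σ.height i)⁻¹ := by
  rw [axisDirection, inner_sum]
  simp_rw [inner_smul_right]
  exact hA.sum_mul_inner hi fun i => (σ.height i)⁻¹

lemma inner_axisDirection_of_notMem (hσ : affineSpan ℝ (Set.range σ.points) = ⊤)
    {A : Finset (Fin (n + 1))} (hA : PairwiseOrthogonal σ Aᶜ) {i : Fin (n + 1)} (hi : i ∉ A) :
    ⟪unitNormal σ i, axisDirection σ A⟫ = -(σ.height i)⁻¹ := by
  rw [← neg_neg (axisDirection σ A), ← axisDirection_compl hσ, inner_neg_right,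
    inner_axisDirection_of_mem hA (Finset.mem_compl.2 hi)]

lemma inner_axisDirection_self {A : Finset (Fin (n + 1))} (hA : PairwiseOrthogonal σ A) :
    ⟪axisDirection σ A, axisDirection σ A⟫ = ∑ i ∈ A, ((σ.height i)⁻¹) ^ 2 := by
  conv_lhs => rw [axisDirection, sum_inner, ← axisDirection]
  refine Finset.sum_congr rfl fun i hi => ?_
  rw [inner_smul_left, conj_trivial, inner_axisDirection_of_mem hA hi, sq]

/-- Both sides are squared norms of axis directions, which are opposite vectors. -/
lemma sum_sq_compl (hσ : affineSpan ℝ (Set.range σ.points) = ⊤)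
    {A : Finset (Fin (n + 1))} (hA : PairwiseOrthogonal σ A) (hA' : PairwiseOrthogonal σ Aᶜ) :
    ∑ i ∈ Aᶜ, ((σ.height i)⁻¹) ^ 2 = ∑ i ∈ A, ((σ.height i)⁻¹) ^ 2 := by
  rw [← inner_axisDirection_self hA, ← inner_axisDirection_self hA', axisDirection_compl hσ,
    inner_neg_neg]

lemma sum_sq_pos (hσ : affineSpan ℝ (Set.range σ.points) = ⊤)
    {A : Finset (Fin (n + 1))} (hA : PairwiseOrthogonal σ A) (hA' : PairwiseOrthogonal σ Aᶜ) :
    0 < ∑ i ∈ A, ((σ.height i)⁻¹) ^ 2 := by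
  have h := sum_sq_compl hσ hA hA'
  have hpos : ∀ i, 0 < ((σ.height i)⁻¹) ^ 2 := fun i => pow_pos (inv_pos.2 (σ.height_pos i)) 2
  by_cases h0 : (0 : Fin (n + 1)) ∈ A
  · exact Finset.sum_pos (fun i _ => hpos i) ⟨0, h0⟩
  · rw [← h]
    exact Finset.sum_pos (fun i _ => hpos i) ⟨0, Finset.mem_compl.2 h0⟩

lemma axisWidth_pos (hσ : affineSpan ℝ (Set.range σ.points) = ⊤)
    {A : Finset (Fin (n + 1))} (hA : PairwiseOrthogonal σ A) (hA' : PairwiseOrthogonal σ Aᶜ) :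
    0 < axisWidth σ A :=
  inv_pos.2 (sum_sq_pos hσ hA hA')

/-- `x` is the point with parameter `t` on the axis belonging to the part `A`. -/
def OnAxis (σ : Simplex ℝ P n) (A : Finset (Fin (n + 1))) (t : ℝ) (x : P) : Prop :=
  (∀ i ∈ A, wallDist σ i x = t * (σ.height i)⁻¹) ∧
    ∀ i ∉ A, wallDist σ i x = (axisWidth σ A - t) * (σ.height i)⁻¹

/-- The prescribed distances satisfy the barycentric constraint because `axisWidth` is the inverse
of the common sum of squares. -/
lemma exists_onAxis (hσ : affineSpan ℝ (Set.range σ.points) = ⊤)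
    {A : Finset (Fin (n + 1))} (hA : PairwiseOrthogonal σ A) (hA' : PairwiseOrthogonal σ Aᶜ)
    (t : ℝ) : ∃ x, OnAxis σ A t x := by
  obtain ⟨x, hx⟩ := exists_wallDist_eq σ (d := fun i => if i ∈ A then t * (σ.height i)⁻¹ else
    (axisWidth σ A - t) * (σ.height i)⁻¹) (by
      have h1 := (sum_sq_pos hσ hA hA').ne'
      rw [← Finset.sum_add_sum_compl A]
      have e1 : ∑ i ∈ A, (σ.height i)⁻¹ * (if i ∈ A then t * (σ.height i)⁻¹ else
          (axisWidth σ A - t) * (σ.height i)⁻¹) = t * ∑ i ∈ A, ((σ.height i)⁻¹) ^ 2 := by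
        rw [Finset.mul_sum]
        refine Finset.sum_congr rfl fun i hi => ?_
        rw [if_pos hi]
        ring
      have e2 : ∑ i ∈ Aᶜ, (σ.height i)⁻¹ * (if i ∈ A then t * (σ.height i)⁻¹ else
          (axisWidth σ A - t) * (σ.height i)⁻¹) =
          (axisWidth σ A - t) * ∑ i ∈ Aᶜ, ((σ.height i)⁻¹) ^ 2 := by
        rw [Finset.mul_sum]
        refine Finset.sum_congr rfl fun i hi => ?_
        rw [if_neg (Finset.mem_compl.1 hi)]
        ring
      rw [e1, e2, sum_sq_compl hσ hA hA', ← add_mul, add_sub_cancel, axisWidth,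
        inv_mul_cancel₀ h1])
  exact ⟨x, fun i hi => by rw [hx, if_pos hi], fun i hi => by rw [hx, if_neg hi]⟩

lemma OnAxis.sum_smul {A : Finset (Fin (n + 1))} {t : ℝ} {x : P} (hx : OnAxis σ A t x) :
    ∑ i ∈ A, wallDist σ i x • unitNormal σ i = t • axisDirection σ A := by
  rw [axisDirection, Finset.smul_sum]
  refine Finset.sum_congr rfl fun i hi => ?_
  rw [hx.1 i hi, mul_smul]

lemma OnAxis.sum_compl_smul (hσ : affineSpan ℝ (Set.range σ.points) = ⊤)
    {A : Finset (Fin (n + 1))} {t : ℝ} {x : P} (hx : OnAxis σ A t x) :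
    ∑ i ∈ Aᶜ, wallDist σ i x • unitNormal σ i = -(axisWidth σ A - t) • axisDirection σ A := by
  rw [neg_smul, ← smul_neg, ← axisDirection_compl hσ, axisDirection, Finset.smul_sum]
  refine Finset.sum_congr rfl fun i hi => ?_
  rw [hx.2 i (Finset.mem_compl.1 hi), mul_smul]

lemma OnAxis.smul_vadd (hσ : affineSpan ℝ (Set.range σ.points) = ⊤)
    {A : Finset (Fin (n + 1))} (hA : PairwiseOrthogonal σ A) (hA' : PairwiseOrthogonal σ Aᶜ)
    {t : ℝ} {x : P} (hx : OnAxis σ A t x) (r : ℝ) :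
    OnAxis σ A (t + r) (r • axisDirection σ A +ᵥ x) := by
  refine ⟨fun i hi => ?_, fun i hi => ?_⟩
  · rw [wallDist_vadd, inner_smul_right, inner_axisDirection_of_mem hA hi, hx.1 i hi]
    ring
  · rw [wallDist_vadd, inner_smul_right, inner_axisDirection_of_notMem hσ hA' hi, hx.2 i hi]
    ring

lemma OnAxis.partReflection (hσ : affineSpan ℝ (Set.range σ.points) = ⊤)
    {A : Finset (Fin (n + 1))} (hA : PairwiseOrthogonal σ A) (hA' : PairwiseOrthogonal σ Aᶜ)
    {t : ℝ} {x : P} (hx : OnAxis σ A t x) : OnAxis σ A (-t) (partReflection σ A x) := by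
  rw [partReflection_apply hσ hA, hx.sum_smul, smul_smul]
  convert! hx.smul_vadd hσ hA hA' (-2 * t) using 1
  ring

lemma OnAxis.partReflection_compl (hσ : affineSpan ℝ (Set.range σ.points) = ⊤)
    {A : Finset (Fin (n + 1))} (hA : PairwiseOrthogonal σ A) (hA' : PairwiseOrthogonal σ Aᶜ)
    {t : ℝ} {x : P} (hx : OnAxis σ A t x) :
    OnAxis σ A (2 * axisWidth σ A - t) (EuclideanCoxeter.partReflection σ Aᶜ x) := by
  rw [partReflection_apply hσ hA', hx.sum_compl_smul hσ, smul_smul]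
  convert! hx.smul_vadd hσ hA hA' (-2 * -(axisWidth σ A - t)) using 1
  ring

/-- The displacement between the two images of a point under the two partial reflections. -/
lemma partReflection_vsub (hσ : affineSpan ℝ (Set.range σ.points) = ⊤)
    {A : Finset (Fin (n + 1))} (hA : PairwiseOrthogonal σ A) (hA' : PairwiseOrthogonal σ Aᶜ)
    (y : P) : partReflection σ A y -ᵥ partReflection σ Aᶜ y =
      (-2 : ℝ) • ∑ i ∈ A, wallDist σ i y • unitNormal σ i +
        (2 : ℝ) • ∑ i ∈ Aᶜ, wallDist σ i y • unitNormal σ i := by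
  rw [partReflection_apply hσ hA, partReflection_apply hσ hA', vadd_vsub_vadd_cancel_right]
  module

/-- Pairing with the axis direction turns the displacement into `-2` times the sum of the
barycentric coordinates. -/
lemma inner_axisDirection_vsub (hσ : affineSpan ℝ (Set.range σ.points) = ⊤)
    {A : Finset (Fin (n + 1))} (hA : PairwiseOrthogonal σ A) (hA' : PairwiseOrthogonal σ Aᶜ)
    (y : P) : ⟪partReflection σ A y -ᵥ partReflection σ Aᶜ y, axisDirection σ A⟫ = -2 := by
  rw [partReflection_vsub hσ hA hA', inner_add_left, inner_smul_left, inner_smul_left, sum_inner,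
    sum_inner]
  simp_rw [inner_smul_left, conj_trivial]
  have e1 : ∑ i ∈ A, wallDist σ i y * ⟪unitNormal σ i, axisDirection σ A⟫ =
      ∑ i ∈ A, (σ.height i)⁻¹ * wallDist σ i y := Finset.sum_congr rfl fun i hi => by
    rw [inner_axisDirection_of_mem hA hi, mul_comm]
  have e2 : ∑ i ∈ Aᶜ, wallDist σ i y * ⟪unitNormal σ i, axisDirection σ A⟫ =
      -∑ i ∈ Aᶜ, (σ.height i)⁻¹ * wallDist σ i y := by
    rw [← Finset.sum_neg_distrib]
    refine Finset.sum_congr rfl fun i hi => ?_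
    rw [inner_axisDirection_of_notMem hσ hA' (Finset.mem_compl.1 hi)]
    ring
  have h := sum_wallDist hσ y
  rw [← Finset.sum_add_sum_compl A] at h
  rw [e1, e2]
  linarith

/-- Pythagoras: the axis direction has squared norm `1 / axisWidth`, so the component of the
displacement along it is constant with squared norm `4 * axisWidth`. The last term is the orthogonal
component. -/
lemma norm_sq_vsub (hσ : affineSpan ℝ (Set.range σ.points) = ⊤)
    {A : Finset (Fin (n + 1))} (hA : PairwiseOrthogonal σ A) (hA' : PairwiseOrthogonal σ Aᶜ)
    (y : P) : ‖partReflection σ A y -ᵥ partReflection σ Aᶜ y‖ ^ 2 = 4 * axisWidth σ A +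
      ‖(partReflection σ A y -ᵥ partReflection σ Aᶜ y) +
        (2 * axisWidth σ A) • axisDirection σ A‖ ^ 2 := by
  rw [norm_add_sq_real, inner_smul_right, inner_axisDirection_vsub hσ hA hA', norm_smul, mul_pow,
    ← real_inner_self_eq_norm_sq (axisDirection σ A), inner_axisDirection_self hA, Real.norm_eq_abs,
    sq_abs]
  have h1 := (sum_sq_pos hσ hA hA').ne'
  have h2 : axisWidth σ A * ∑ i ∈ A, ((σ.height i)⁻¹) ^ 2 = 1 := inv_mul_cancel₀ h1
  linear_combination (-4 * axisWidth σ A) * h2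

lemma vsub_add_eq_zero_iff (hσ : affineSpan ℝ (Set.range σ.points) = ⊤)
    {A : Finset (Fin (n + 1))} (hA : PairwiseOrthogonal σ A) (hA' : PairwiseOrthogonal σ Aᶜ)
    (y : P) : (partReflection σ A y -ᵥ partReflection σ Aᶜ y) +
        (2 * axisWidth σ A) • axisDirection σ A = 0 ↔ ∃ t, OnAxis σ A t y := by
  rw [partReflection_vsub hσ hA hA']
  constructor
  · intro h
    have hd : ∑ i, (if i ∈ A then axisWidth σ A * (σ.height i)⁻¹ - wallDist σ i y else
        wallDist σ i y) • unitNormal σ i = 0 := by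
      rw [← Finset.sum_add_sum_compl A]
      have e1 : ∑ i ∈ A, (if i ∈ A then axisWidth σ A * (σ.height i)⁻¹ - wallDist σ i y else
          wallDist σ i y) • unitNormal σ i = axisWidth σ A • axisDirection σ A -
            ∑ i ∈ A, wallDist σ i y • unitNormal σ i := by
        rw [axisDirection, Finset.smul_sum, ← Finset.sum_sub_distrib]
        refine Finset.sum_congr rfl fun i hi => ?_
        rw [if_pos hi, sub_smul, mul_smul]
      have e2 : ∑ i ∈ Aᶜ, (if i ∈ A then axisWidth σ A * (σ.height i)⁻¹ - wallDist σ i y else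
          wallDist σ i y) • unitNormal σ i = ∑ i ∈ Aᶜ, wallDist σ i y • unitNormal σ i :=
        Finset.sum_congr rfl fun i hi => by rw [if_neg (Finset.mem_compl.1 hi)]
      rw [e1, e2]
      refine (smul_eq_zero_iff_right (two_ne_zero (α := ℝ))).1 ?_
      rw [← h]
      module
    obtain ⟨μ, hμ⟩ := eq_smul_of_sum_smul_unitNormal_eq_zero σ hd
    -- Uniqueness of the relation makes every coefficient `μ * (σ.height i)⁻¹`; off `A` this is the
    -- distance for the parameter `axisWidth - μ`.
    refine ⟨axisWidth σ A - μ, fun i hi => ?_, fun i hi => ?_⟩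
    · have := hμ i
      rw [if_pos hi] at this
      linarith
    · have := hμ i
      rw [if_neg hi] at this
      rw [this]
      ring
  · rintro ⟨t, ht⟩
    rw [ht.sum_smul, ht.sum_compl_smul hσ]
    module

/-- The min-set of a bipartite Coxeter element is the axis. -/
lemma mem_minSet_iff (hσ : affineSpan ℝ (Set.range σ.points) = ⊤)
    {A : Finset (Fin (n + 1))} (hA : PairwiseOrthogonal σ A) (hA' : PairwiseOrthogonal σ Aᶜ)
    (x : P) : x ∈ minSet (partReflection σ A * partReflection σ Aᶜ) ↔ ∃ t, OnAxis σ A t x := by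
  have hinv : ∀ z, partReflection σ Aᶜ (partReflection σ Aᶜ z) = z := fun z =>
    congrArg (fun g : P ≃ᵃⁱ[ℝ] P => g z) (partReflection_mul_self hσ hA')
  -- With `y = partReflection σ Aᶜ z`, the points `z` and `w z` are the images of `y` under the two
  -- partial reflections.
  have hdist : ∀ z, dist z ((partReflection σ A * partReflection σ Aᶜ) z) ^ 2 =
      4 * axisWidth σ A + ‖(partReflection σ A (partReflection σ Aᶜ z) -ᵥ
        partReflection σ Aᶜ (partReflection σ Aᶜ z)) +
        (2 * axisWidth σ A) • axisDirection σ A‖ ^ 2 := by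
    intro z
    rw [← norm_sq_vsub hσ hA hA', hinv, dist_comm, dist_eq_norm_vsub V]
    rfl
  have haxis : ∀ z, (∃ t, OnAxis σ A t (partReflection σ Aᶜ z)) ↔ ∃ t, OnAxis σ A t z := by
    refine fun z => ⟨?_, ?_⟩
    · rintro ⟨t, ht⟩
      have := ht.partReflection_compl hσ hA hA'
      rw [hinv] at this
      exact ⟨_, this⟩
    · rintro ⟨t, ht⟩
      exact ⟨_, ht.partReflection_compl hσ hA hA'⟩
  rw [← haxis, ← vsub_add_eq_zero_iff hσ hA hA']
  constructor
  · intro hx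
    obtain ⟨x₀, hx₀⟩ := exists_onAxis hσ hA hA' 0
    have h := pow_le_pow_left₀ dist_nonneg (hx x₀) 2
    rw [hdist, hdist, (vsub_add_eq_zero_iff hσ hA hA' _).2 ((haxis x₀).2 ⟨0, hx₀⟩), norm_zero] at h
    rw [← norm_eq_zero]
    refine pow_eq_zero_iff two_ne_zero |>.1 (le_antisymm ?_ (sq_nonneg _))
    linarith
  · intro hx y
    refine (pow_le_pow_iff_left₀ dist_nonneg dist_nonneg two_ne_zero).1 ?_
    rw [hdist, hdist, hx, norm_zero]
    have := sq_nonneg ‖(partReflection σ A (partReflection σ Aᶜ y) -ᵥ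
        partReflection σ Aᶜ (partReflection σ Aᶜ y)) +
        (2 * axisWidth σ A) • axisDirection σ A‖
    linarith

lemma OnAxis.zpow (hσ : affineSpan ℝ (Set.range σ.points) = ⊤)
    {A : Finset (Fin (n + 1))} (hA : PairwiseOrthogonal σ A) (hA' : PairwiseOrthogonal σ Aᶜ)
    (k : ℤ) {t : ℝ} {x : P} (hx : OnAxis σ A t x) :
    OnAxis σ A (t - 2 * k * axisWidth σ A)
      (((EuclideanCoxeter.partReflection σ A * EuclideanCoxeter.partReflection σ Aᶜ) ^ k) x) := by
  induction k using Int.induction_on with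
  | zero => simpa using hx
  | succ k ih =>
    rw [zpow_add_one, (Commute.zpow_self _ _).eq]
    convert! (ih.partReflection_compl hσ hA hA').partReflection hσ hA hA' using 1
    push_cast
    ring
  | pred k ih =>
    rw [zpow_sub_one, ← zpow_neg_one, (Commute.zpow_zpow_self _ _ _).eq, zpow_neg_one, mul_inv_rev,
      inv_eq_of_mul_eq_one_left (partReflection_mul_self hσ hA'),
      inv_eq_of_mul_eq_one_left (partReflection_mul_self hσ hA)]
    convert! (ih.partReflection hσ hA hA').partReflection_compl hσ hA hA' using 1
    push_cast
    ring

/-- The dihedral group generated by the two partial reflections moves every point of the axis into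
the closed simplex. -/
lemma OnAxis.exists_wallDist_nonneg (hσ : affineSpan ℝ (Set.range σ.points) = ⊤)
    {A : Finset (Fin (n + 1))} (hA : PairwiseOrthogonal σ A) (hA' : PairwiseOrthogonal σ Aᶜ)
    {t : ℝ} {x : P} (hx : OnAxis σ A t x) :
    ∃ h ∈ reflectionGroup σ, (∀ i, 0 ≤ wallDist σ i (h x)) ∧
      ∀ w, w = EuclideanCoxeter.partReflection σ A * EuclideanCoxeter.partReflection σ Aᶜ →
        h * w * h⁻¹ = w ∨ h * w * h⁻¹ = w⁻¹ := by
  have hT := axisWidth_pos hσ hA hA'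
  have hnn : ∀ {s : ℝ} {y : P}, OnAxis σ A s y → 0 ≤ s → s ≤ axisWidth σ A →
      ∀ i, 0 ≤ wallDist σ i y := by
    intro s y hy h0 h1 i
    have hi := (inv_pos.2 (σ.height_pos i)).le
    by_cases hiA : i ∈ A
    · rw [hy.1 i hiA]
      exact mul_nonneg h0 hi
    · rw [hy.2 i hiA]
      exact mul_nonneg (sub_nonneg.2 h1) hi
  set a := EuclideanCoxeter.partReflection σ A with ha
  set b := EuclideanCoxeter.partReflection σ Aᶜ with hb
  have hmem : a * b ∈ reflectionGroup σ := mul_mem (partReflection_mem σ A) (partReflection_mem σ _)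
  have haa : a * a = 1 := partReflection_mul_self hσ hA
  have hbb : b * b = 1 := partReflection_mul_self hσ hA'
  -- The product translates the parameter by `-2 * axisWidth`. Rounding brings it within `axisWidth`
  -- of 0, and a negative value is then reflected by `a`.
  have hk := abs_le.1 (abs_sub_round (t / (2 * axisWidth σ A)))
  set k := round (t / (2 * axisWidth σ A))
  have ht : t = t / (2 * axisWidth σ A) * (2 * axisWidth σ A) := by field_simp
  have hax := hx.zpow hσ hA hA' k
  have hcomm : (a * b) ^ k * (a * b) * ((a * b) ^ k)⁻¹ = a * b := by
    rw [(Commute.zpow_self _ _).eq, mul_inv_cancel_right]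
  have hlow : -axisWidth σ A ≤ t - 2 * k * axisWidth σ A := by
    rw [ht]
    nlinarith
  have hupp : t - 2 * k * axisWidth σ A ≤ axisWidth σ A := by
    rw [ht]
    nlinarith
  rcases le_total 0 (t - 2 * k * axisWidth σ A) with h0 | h0
  · refine ⟨(a * b) ^ k, zpow_mem hmem k, hnn hax h0 hupp, ?_⟩
    rintro _ rfl
    exact Or.inl hcomm
  · refine ⟨a * (a * b) ^ k, mul_mem (partReflection_mem σ A) (zpow_mem hmem k),
      hnn (hax.partReflection hσ hA hA') (by linarith) (by linarith), ?_⟩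
    rintro _ rfl
    right
    have : a * (a * b) ^ k * (a * b) * (a * (a * b) ^ k)⁻¹ =
        a * ((a * b) ^ k * (a * b) * ((a * b) ^ k)⁻¹) * a⁻¹ := by group
    rw [this, hcomm, mul_inv_rev, inv_eq_of_mul_eq_one_left haa, inv_eq_of_mul_eq_one_left hbb,
      ← mul_assoc, haa, one_mul]

end Axis

/-! ### Bipartite orderings and their reversal. -/

section Orderings

variable {n : ℕ} {M : CoxeterMatrix (Fin (n + 1))}

/-- Only pairs whose order is exchanged by the sorting need to commute. -/
lemma prod_map_eq_prod_filter_mul {ι G : Type*} [Group G] (s : ι → G) (p : ι → Prop)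
    [DecidablePred p] {L : List ι}
    (h : L.Pairwise fun x y => ¬ p x → p y → Commute (s x) (s y)) :
    (L.map s).prod = ((L.filter p).map s).prod * ((L.filter (¬ p ·)).map s).prod := by
  induction L with
  | nil => simp
  | cons x L ih =>
    obtain ⟨hx, hL⟩ := List.pairwise_cons.1 h
    rw [List.map_cons, List.prod_cons, ih hL]
    by_cases hp : p x
    · rw [List.filter_cons_of_pos (by simpa using hp), List.filter_cons_of_neg (by simpa using hp),
        List.map_cons, List.prod_cons, mul_assoc]
    · rw [List.filter_cons_of_neg (by simpa using hp), List.filter_cons_of_pos (by simpa using hp),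
        List.map_cons, List.prod_cons, ← mul_assoc, ← mul_assoc]
      congr 1
      refine (commute_list_prod fun y hy => ?_).eq
      obtain ⟨hy, hpy⟩ := List.mem_filter.1 hy
      exact hx y hy hp (by simpa using hpy)

/-- A forest has a bipartite ordering. -/
lemma exists_isBipartiteOrdering (hΓ : (diagram M).IsAcyclic) : ∃ e, IsBipartiteOrdering M e := by
  obtain ⟨c⟩ := hΓ.colorable_two
  have key : ∀ i j, c i < c j → (Tuple.sort c).symm i < (Tuple.sort c).symm j := by
    intro i j hij
    by_contra hle
    have := Tuple.monotone_sort c (not_lt.1 hle)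
    simp only [Function.comp_apply, Equiv.apply_symm_apply] at this
    exact absurd hij (not_lt.2 this)
  refine ⟨Tuple.sort c, fun i => ?_⟩
  by_cases hi : c i = 0
  · refine Or.inl fun j hj => key i j ?_
    have := c.valid hj
    omega
  · refine Or.inr fun j hj => key j i ?_
    have := c.valid hj
    omega

/-- Reversal exchanges sources and sinks. -/
lemma IsBipartiteOrdering.rev {e : Equiv.Perm (Fin (n + 1))} (he : IsBipartiteOrdering M e) :
    IsBipartiteOrdering M (Fin.revPerm.trans e) := by
  intro i
  refine (he i).symm.imp (fun h j hj => ?_) (fun h j hj => ?_) <;>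
  · rw [Equiv.symm_trans_apply, Equiv.symm_trans_apply, Fin.revPerm_symm, Fin.revPerm_apply,
      Fin.revPerm_apply, Fin.rev_lt_rev]
    exact h j hj

lemma ofFn_rev {α : Type*} {m : ℕ} (f : Fin m → α) :
    List.ofFn (fun i => f i.rev) = (List.ofFn f).reverse := by
  refine List.ext_getElem (by simp) fun i h₁ h₂ => ?_
  rw [List.getElem_ofFn, List.getElem_reverse, List.getElem_ofFn]
  congr 1
  rw [Fin.ext_iff, Fin.val_rev]
  simp only [List.length_ofFn]
  omega

end Orderings

/-! ### Bipartite factorization and the axis inside a chamber. -/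

section Main

variable {V P : Type*} [NormedAddCommGroup V] [InnerProductSpace ℝ V] [MetricSpace P]
  [NormedAddTorsor V P] {n : ℕ} [NeZero n] {σ : Simplex ℝ P n} {M : CoxeterMatrix (Fin (n + 1))}

lemma orderedProduct_rev (σ : Simplex ℝ P n) (e : Equiv.Perm (Fin (n + 1))) :
    orderedProduct σ (Fin.revPerm.trans e) = (orderedProduct σ e)⁻¹ := by
  rw [orderedProduct, orderedProduct, List.prod_inv_reverse, List.map_ofFn,
    ← ofFn_rev]
  congr 2

/-- The sources of a bipartite ordering split the product into two partial reflections. -/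
lemma IsBipartiteOrdering.exists_part (hσ : IsCoxeterSimplex σ M) {e : Equiv.Perm (Fin (n + 1))}
    (he : IsBipartiteOrdering M e) : ∃ A, PairwiseOrthogonal σ A ∧ PairwiseOrthogonal σ Aᶜ ∧
      orderedProduct σ e = partReflection σ A * partReflection σ Aᶜ := by
  classical
  set A : Finset (Fin (n + 1)) := Finset.univ.filter (IsSource M e) with hAdef
  have hsource : ∀ {i}, i ∈ A ↔ IsSource M e i := by simp [hAdef]
  have hsink : ∀ {i}, i ∉ A → IsSink M e i := fun hi => (he _).resolve_left (hsource.not.1 hi)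
  have hA : PairwiseOrthogonal σ A := fun i hi j hj hij =>
    inner_unitNormal_of_not_adj hσ hij fun h =>
      lt_asymm (hsource.1 hi j h) (hsource.1 hj i h.symm)
  have hA' : PairwiseOrthogonal σ Aᶜ := fun i hi j hj hij =>
    inner_unitNormal_of_not_adj hσ hij fun h =>
      lt_asymm (hsink (Finset.mem_compl.1 hi) j h) (hsink (Finset.mem_compl.1 hj) i h.symm)
  refine ⟨A, hA, hA', ?_⟩
  have hpw : (List.ofFn e).Pairwise fun x y =>
      ¬ x ∈ A → y ∈ A → Commute (facetReflection σ x) (facetReflection σ y) := by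
    rw [List.pairwise_ofFn]
    -- All neighbours of the sink `x` precede it, so it is not adjacent to the later source `y`.
    intro i j hij hx hy
    refine commute_facetReflection hσ fun h => lt_asymm hij ?_
    simpa using hsink hx _ h
  have hnd : (List.ofFn e).Nodup := List.nodup_ofFn.2 e.injective
  have h1 : ((List.ofFn e).filter (· ∈ A)).toFinset = A := by
    ext x
    rw [List.mem_toFinset, List.mem_filter, List.mem_ofFn]
    simp only [decide_eq_true_eq, and_iff_right_iff_imp]
    exact fun _ => e.surjective x
  have h2 : ((List.ofFn e).filter (¬ · ∈ A)).toFinset = Aᶜ := by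
    ext x
    rw [List.mem_toFinset, List.mem_filter, List.mem_ofFn, Finset.mem_compl]
    simp only [decide_eq_true_eq, and_iff_right_iff_imp]
    exact fun _ => e.surjective x
  have hprod := prod_map_eq_prod_filter_mul (facetReflection σ) (· ∈ A) hpw
  rw [List.map_ofFn] at hprod
  rw [orderedProduct]
  refine hprod.trans ?_
  congr 1
  · ext x
    rw [prod_map_facetReflection_apply hσ.span_eq_top (hnd.filter _) (by rwa [h1]), h1,
      partReflection_apply hσ.span_eq_top hA]
  · ext x
    rw [prod_map_facetReflection_apply hσ.span_eq_top (hnd.filter _) (by rwa [h2]), h2,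
      partReflection_apply hσ.span_eq_top hA']

lemma minSet_inter_interior_nonempty (hσ : IsCoxeterSimplex σ M) {e : Equiv.Perm (Fin (n + 1))}
    (he : IsBipartiteOrdering M e) : (minSet (orderedProduct σ e) ∩ σ.interior).Nonempty := by
  obtain ⟨A, hA, hA', h⟩ := he.exists_part hσ
  have hT := axisWidth_pos hσ.span_eq_top hA hA'
  -- The midpoint of the axis segment, where all wall functions are positive.
  obtain ⟨x, hx⟩ := exists_onAxis hσ.span_eq_top hA hA' (axisWidth σ A / 2)
  refine ⟨x, ?_, (mem_interior_iff_wallDist_pos hσ.span_eq_top).2 fun i => ?_⟩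
  · rw [h, mem_minSet_iff hσ.span_eq_top hA hA']
    exact ⟨_, hx⟩
  · have hi := inv_pos.2 (σ.height_pos i)
    by_cases hiA : i ∈ A
    · rw [hx.1 i hiA]
      positivity
    · rw [hx.2 i hiA]
      exact mul_pos (by linarith) hi

/-- Every Coxeter element is produced as a bipartite Coxeter element by some chamber. -/
lemma IsCoxeterElement.exists_bipartite (hσ : IsCoxeterSimplex σ M)
    (hΓ : (diagram M).IsAcyclic) {w : P ≃ᵃⁱ[ℝ] P} (hw : IsCoxeterElement σ w) :
    ∃ g ∈ reflectionGroup σ, ∃ e, IsBipartiteOrdering M e ∧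
      w = orderedProduct (imageSimplex g σ) e := by
  obtain ⟨τ, hτ, e, rfl⟩ := hw
  obtain ⟨g, hg, rfl⟩ := isChamber_iff.1 hτ
  obtain ⟨e', he'⟩ := exists_isBipartiteOrdering hΓ
  obtain ⟨h, hh, heq⟩ := exists_conj_orderedProduct hσ hΓ e' e
  refine ⟨g * h, mul_mem hg hh, e', he', ?_⟩
  rw [orderedProduct_imageSimplex _ hσ.span_eq_top, orderedProduct_imageSimplex _ hσ.span_eq_top,
    heq]
  group

lemma reflectionGroup_imageSimplex_le (hσ : affineSpan ℝ (Set.range σ.points) = ⊤)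
    {g : P ≃ᵃⁱ[ℝ] P} (hg : g ∈ reflectionGroup σ) :
    reflectionGroup (imageSimplex g σ) ≤ reflectionGroup σ := by
  rw [reflectionGroup, Subgroup.closure_le]
  rintro _ ⟨i, rfl⟩
  exact facetReflection_imageSimplex_mem hσ hg i

end Main

end EuclideanCoxeter

end
theorem mainTheorem6 {V P : Type*} [NormedAddCommGroup V] [InnerProductSpace ℝ V]
    [MetricSpace P] [NormedAddTorsor V P] {n : ℕ} [NeZero n]
    (M : CoxeterMatrix (Fin (n + 1))) (hA : ¬ EuclideanCoxeter.IsTypeA M)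
    (σ₀ : Affine.Simplex ℝ P n) (hσ₀ : EuclideanCoxeter.IsCoxeterSimplex σ₀ M)
    (w : P ≃ᵃⁱ[ℝ] P) (hw : EuclideanCoxeter.IsCoxeterElement σ₀ w)
    (σ : Affine.Simplex ℝ P n) (hσ : EuclideanCoxeter.IsChamber σ₀ σ) :
    EuclideanCoxeter.ProducesBipartite M σ w ↔
      (EuclideanCoxeter.minSet w ∩ σ.interior).Nonempty := by
  open EuclideanCoxeter in
  have hM := entry_ne_zero hA hσ₀
  have hΓ := isAcyclic_diagram hA hσ₀
  obtain ⟨g, hg, hσg⟩ := isChamber_iff.1 hσ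
  have hσM : IsCoxeterSimplex σ M := hσg ▸ hσ₀.imageSimplex g
  constructor
  · rintro ⟨e, he, rfl⟩
    exact minSet_inter_interior_nonempty hσM he
  · rintro ⟨x, hxw, hxσ⟩
    obtain ⟨f, hf, e, he, hwe⟩ := hw.exists_bipartite hσ₀ hΓ
    have hτ := hσ₀.imageSimplex f
    have hle := reflectionGroup_imageSimplex_le hσ₀.span_eq_top hf
    set τ := imageSimplex f σ₀ with hτdef
    obtain ⟨A, hA₁, hA₂, hAe⟩ := he.exists_part hτ
    rw [hwe, hAe, mem_minSet_iff hτ.span_eq_top hA₁ hA₂] at hxw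
    obtain ⟨t, ht⟩ := hxw
    obtain ⟨h, hh, hpos, hconj⟩ := ht.exists_wallDist_nonneg hτ.span_eq_top hA₁ hA₂
    -- The point `x` is interior to `σ` and lies in the closed chamber `h⁻¹ τ`, because `h x` lies
    -- in the closed chamber `τ`.
    have hστ : σ = imageSimplex h⁻¹ τ := by
      refine hσ.eq_of_wallDist hσ₀ hM (isChamber_iff.2 ⟨h⁻¹ * f, mul_mem (inv_mem (hle hh)) hf,
        rfl⟩) ((mem_interior_iff_wallDist_pos hσM.span_eq_top).1 hxσ) fun i => ?_
      have e : x = h⁻¹ (h x) := by simp [AffineIsometryEquiv.coe_inv]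
      rw [e, wallDist_imageSimplex]
      exact hpos i
    have hprod : ∀ e', orderedProduct σ e' = h⁻¹ * orderedProduct τ e' * h := fun e' => by
      rw [hστ, orderedProduct_imageSimplex _ hτ.span_eq_top, inv_inv]
    rcases hconj w (hwe.trans hAe) with hc | hc
    · refine ⟨e, he, ?_⟩
      rw [hprod, ← hwe]
      nth_rewrite 2 [← hc]
      group
    -- When `h` inverts `w`, the reversed ordering supplies the second inversion.
    · refine ⟨Fin.revPerm.trans e, he.rev, ?_⟩
      rw [hprod, orderedProduct_rev, ← hwe, ← hc]
      group
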